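/- **Setting.** Let $n\in\mathbb N$, let $\mathbb D\subset\mathbb R^2$ be the open unit disk, and let $A_2(\mathbb R^n)=\{[\![P_1]\!]+[\![P_2]\!] : P_1,P_2\in\mathbb R^n\}$ be the set of unordered pairs of points of $\mathbb R^n$ (sums of two Dirac masses), with the metric $\mathcal G([\![P_1]\!]+[\![P_2]\!],[\![Q_1]\!]+[\![Q_2]\!])=\min_{\sigma\in S_2}\big(\sum_i|P_i-Q_{\sigma(i)}|^2\big)^{1/2}$. Let $\zeta:A_2(\mathbb R^n)\to\mathbb R^N$ be the Almgren–White embedding, obtained by recording, for each vector $v$ of each of $n^2$ orthonormal bases of $\mathbb R^n$ (for $i<j$ the standard basis rotated by $45^\circ$ in the $(i,j)$-plane, for $i\ge j$ the standard basis), the numbers $\frac1n\langle v,P_1\rangle,\frac1n\langle v,P_2\rangle$ in increasing order; it is $1$-Lipschitz and injective, has Lipschitz inverse on its image, and for every $T$ satisfies $|\zeta(S)-\zeta(T)|=\mathcal G(S,T)$ for all $S$ near $T$. A map $f:\mathbb D\to A_2(\mathbb R^n)$ belongs to $W^{1,2}(\mathbb D,A_2(\mathbb R^n))$ if $\zeta\circ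 f\in W^{1,2}(\mathbb D,\mathbb R^N)$; its Dirichlet energy is $\mathrm{Dir}(f)=\int_{\mathbb D}|D(\zeta\circ f)|^2$, and $\mathrm{Dir}(f)=+\infty$ if $f\notin W^{1,2}$. For $u:\mathbb D\to\mathbb R^n$ likewise $\mathrm{Dir}(u)=\int_{\mathbb D}|Du|^2$ if $u\in W^{1,2}(\mathbb D,\mathbb R^n)$ and $+\infty$ otherwise. Boundary values are $W^{1,2}$-traces of $\zeta\circ f$ on $S^1$, and $f\in W^{1,2}(\mathbb D,A_2(\mathbb R^n))$ is Dirichlet minimizing if $\mathrm{Dir}(f)\le\mathrm{Dir}(g)$ for every $g\in W^{1,2}(\mathbb D,A_2(\mathbb R^n))$ with the same trace. For $H=[\![h_1]\!]+[\![h_2]\!]$ and $f:\mathbb D\to\mathbb R^n$ write $H\pm f=[\![h_1\pm f]\!]+[\![h_2\pm f]\!]$. **Proposition.** Let $H\in W^{1,2}(\mathbb D,A_2(\mathbb R^n))$ be Dirichlet minimizing with $H|_{S^1}=[\![H_1]\!]+[\![H_2]\!]$ in the sense of traces, where $H_1,H_2:S^1\to\mathbb R^n$ are continuous, and let $h$ be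 the harmonic extension of $H_1$ to $\mathbb D$ (harmonic in $\mathbb D$, continuous on $\overline{\mathbb D}$, equal to $H_1$ on $S^1$). 1. If $H_2=-H_1$, then $\mathrm{Dir}(H+h)=\mathrm{Dir}(H)+2\,\mathrm{Dir}(h)$ as an identity in $[0,\infty]$ (both sides are $+\infty$ when $h\notin W^{1,2}$). 2. If $H_2=0$, then $\mathrm{Dir}(H-\tfrac h2)$ and $\mathrm{Dir}(\tfrac h2)$ are finite and $\mathrm{Dir}(H-\tfrac h2)=\mathrm{Dir}(H)-2\,\mathrm{Dir}(\tfrac h2)$. -/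

import Mathlib

open scoped ContDiff

namespace TwoValued

/-- The Euclidean space `ℝⁿ`. -/
abbrev E (n : ℕ) := EuclideanSpace ℝ (Fin n)

/-- `A₂(ℝⁿ)`: the sums `⟦P₁⟧ + ⟦P₂⟧` of two Dirac masses, i.e. unordered pairs of points. -/
abbrev A2 (n : ℕ) := Sym2 (E n)

/-- The open unit disk. -/
abbrev disk : Set ℂ := Metric.ball (0 : ℂ) 1

/-! ### The metric on `A₂(ℝⁿ)` and the Almgren–White embedding -/

/-- The metric `𝒢 (⟦a⟧ + ⟦b⟧, ⟦c⟧ + ⟦d⟧)`: the minimum over the two matchings of the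
`ℓ²`-cost. -/
noncomputable def dist2 {n : ℕ} : A2 n → A2 n → ℝ :=
  Sym2.lift₂ ⟨fun a b c d =>
    min (√(‖a - c‖ ^ 2 + ‖b - d‖ ^ 2)) (√(‖a - d‖ ^ 2 + ‖b - c‖ ^ 2)), by
      intro a b c d
      dsimp only
      constructor
      · rw [min_comm, add_comm (‖a - d‖ ^ 2), add_comm (‖a - c‖ ^ 2)]
      · rw [min_comm]⟩

/-- The orthonormal bases of `ℝⁿ` used in the embedding: for `i < j` the standard basis rotated
by 45 degrees in the `(i, j)`-plane, otherwise the standard basis. -/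
noncomputable def frame (n : ℕ) (i j k : Fin n) : E n :=
  if i < j ∧ k = i then
    (√2)⁻¹ • (EuclideanSpace.single i (1 : ℝ) + EuclideanSpace.single j (1 : ℝ))
  else if i < j ∧ k = j then
    (√2)⁻¹ • (EuclideanSpace.single i (1 : ℝ) - EuclideanSpace.single j (1 : ℝ))
  else EuclideanSpace.single k (1 : ℝ)

/-- The Euclidean space `ℝᴺ` containing the image of the embedding. -/
abbrev EN (n : ℕ) := EuclideanSpace ℝ (Fin n × Fin n × Fin n × Fin 2)

/-- The Almgren–White embedding `ζ : A₂(ℝⁿ) → ℝᴺ`: for each of the `n²` orthonormal bases and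
each vector `v` of it, record the two numbers `⟪v, P⟫`, `⟪v, Q⟫` in increasing order; the factor
`1 / n` normalizes for the number of bases. -/
noncomputable def zeta {n : ℕ} : A2 n → EN n :=
  Sym2.lift ⟨fun P Q => WithLp.toLp 2 fun p =>
    (n : ℝ)⁻¹ *
      (if p.2.2.2 = 0 then
        min (inner ℝ (frame n p.1 p.2.1 p.2.2.1) P) (inner ℝ (frame n p.1 p.2.1 p.2.2.1) Q)
      else
        max (inner ℝ (frame n p.1 p.2.1 p.2.2.1) P) (inner ℝ (frame n p.1 p.2.1 p.2.2.1) Q)),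
    by intro P Q; simp only [min_comm, max_comm]⟩

/-! ### Sobolev functions, Dirichlet energy and traces on the disk -/

section Sobolev

variable {F : Type*} [NormedAddCommGroup F] [InnerProductSpace ℝ F]

/-- `g` is the weak derivative of `u` in the direction `v` on the disk. -/
def HasWeakPartial (u g : ℂ → F) (v : ℂ) : Prop :=
  ∀ φ : ℂ → ℝ, ContDiff ℝ ∞ φ → HasCompactSupport φ → tsupport φ ⊆ disk →
    ∫ z in disk, (fderiv ℝ φ z v) • u z = -∫ z in disk, φ z • g z

/-- `u` is in `W^{1,2}` of the disk, with weak partial derivatives `g₁ = ∂u/∂x`,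
`g₂ = ∂u/∂y`. -/
structure IsWeakGradient (u g₁ g₂ : ℂ → F) : Prop where
  memLp : MeasureTheory.MemLp u 2 (MeasureTheory.volume.restrict disk)
  memLp_re : MeasureTheory.MemLp g₁ 2 (MeasureTheory.volume.restrict disk)
  memLp_im : MeasureTheory.MemLp g₂ 2 (MeasureTheory.volume.restrict disk)
  partial_re : HasWeakPartial u g₁ 1
  partial_im : HasWeakPartial u g₂ Complex.I

/-- `u ∈ W^{1,2}(𝔻, F)`. -/
def MemW12 (u : ℂ → F) : Prop := ∃ g₁ g₂ : ℂ → F, IsWeakGradient u g₁ g₂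

/-- The Dirichlet energy `∫_𝔻 |Du|²` (Hilbert–Schmidt norm) if `u ∈ W^{1,2}(𝔻, F)`, and `∞`
otherwise. The weak gradient is unique up to null sets, so the infimum is over one value; see
`dir_eq`. -/
noncomputable def dir (u : ℂ → F) : ENNReal :=
  ⨅ (g : (ℂ → F) × (ℂ → F)) (_ : IsWeakGradient u g.1 g.2),
    ∫⁻ z in disk, (‖g.1 z‖ₑ ^ 2 + ‖g.2 z‖ₑ ^ 2)

/-- `u ∈ W^{1,2}(𝔻, F)` has trace `t ∈ L²(S¹, F)`: for all `C¹` vector fields `(φ₁, φ₂)`,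
`∫_𝔻 u div φ = - ∫_𝔻 (φ₁ ∂₁u + φ₂ ∂₂u) + ∫_{S¹} (φ · ν) t`. -/
def HasTrace (u : ℂ → F) (t : Circle → F) : Prop :=
  MeasureTheory.MemLp (fun θ : ℝ => t (Circle.exp θ)) 2
    (MeasureTheory.volume.restrict (Set.Ioc 0 (2 * Real.pi))) ∧
  ∃ g₁ g₂ : ℂ → F, IsWeakGradient u g₁ g₂ ∧
    ∀ φ₁ φ₂ : ℂ → ℝ, ContDiff ℝ 1 φ₁ → ContDiff ℝ 1 φ₂ →
      ∫ z in disk, (fderiv ℝ φ₁ z 1 + fderiv ℝ φ₂ z Complex.I) • u z =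
        -(∫ z in disk, (φ₁ z • g₁ z + φ₂ z • g₂ z)) +
        ∫ θ in (0 : ℝ)..(2 * Real.pi),
          (φ₁ (Circle.exp θ) * Real.cos θ + φ₂ (Circle.exp θ) * Real.sin θ) • t (Circle.exp θ)

/-- `h` is the harmonic extension to the disk of the continuous function `b` on the circle. -/
structure IsHarmonicExtension (b : Circle → F) (h : ℂ → F) : Prop where
  harmonic : InnerProductSpace.HarmonicOnNhd h disk
  continuousOn : ContinuousOn h (Metric.closedBall (0 : ℂ) 1)
  boundary : ∀ z : Circle, h z = b z

end Sobolev

/-! ### Two-valued Sobolev functions -/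

/-- `f ∈ W^{1,2}(𝔻, A₂(ℝⁿ))`. -/
def MemW12A2 {n : ℕ} (f : ℂ → A2 n) : Prop := MemW12 fun z => zeta (f z)

/-- The Dirichlet energy of a two-valued function; it is `∞` if `f ∉ W^{1,2}(𝔻, A₂(ℝⁿ))`. -/
noncomputable def dirA2 {n : ℕ} (f : ℂ → A2 n) : ENNReal := dir fun z => zeta (f z)

/-- `f|_{S¹} = b` in the sense of traces. -/
def HasTraceA2 {n : ℕ} (f : ℂ → A2 n) (b : Circle → A2 n) : Prop :=
  HasTrace (fun z => zeta (f z)) (fun z => zeta (b z))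

/-- `f` and `g` have the same trace on the circle. -/
def SameTrace {n : ℕ} (f g : ℂ → A2 n) : Prop :=
  ∃ t : Circle → EN n, HasTrace (fun z => zeta (f z)) t ∧ HasTrace (fun z => zeta (g z)) t

/-- `f ∈ W^{1,2}(𝔻, A₂(ℝⁿ))` is Dirichlet minimizing. -/
def IsDirMinimizing {n : ℕ} (f : ℂ → A2 n) : Prop :=
  MemW12A2 f ∧ ∀ g : ℂ → A2 n, MemW12A2 g → SameTrace f g → dirA2 f ≤ dirA2 g

/-- `H + f = ⟦h₁ + f⟧ + ⟦h₂ + f⟧` for `H = ⟦h₁⟧ + ⟦h₂⟧` and a single-valued `f`. -/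
def addFun {n : ℕ} (H : ℂ → A2 n) (f : ℂ → E n) : ℂ → A2 n :=
  fun z => (H z).map fun p => p + f z

/-! ### Sanity facts -/

theorem dir_eq {F : Type*} [NormedAddCommGroup F] [InnerProductSpace ℝ F] [CompleteSpace F]
    {u g₁ g₂ : ℂ → F} (hu : IsWeakGradient u g₁ g₂) :
    dir u = ∫⁻ z in disk, (‖g₁ z‖ₑ ^ 2 + ‖g₂ z‖ₑ ^ 2) := by
  have key : ∀ (v : ℂ) (g g' : ℂ → F),
      MeasureTheory.MemLp g 2 (MeasureTheory.volume.restrict disk) →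
      MeasureTheory.MemLp g' 2 (MeasureTheory.volume.restrict disk) →
      HasWeakPartial u g v → HasWeakPartial u g' v →
      ∀ᵐ z ∂(MeasureTheory.volume.restrict disk), g z = g' z := by
    intro v g g' hg hg' h h'
    have : MeasureTheory.IsFiniteMeasure (MeasureTheory.volume.restrict disk) :=
      MeasureTheory.isFiniteMeasure_restrict.mpr
        (MeasureTheory.measure_ball_lt_top (μ := MeasureTheory.volume)).ne
    have hi : MeasureTheory.IntegrableOn g disk := hg.integrable one_le_two
    have hi' : MeasureTheory.IntegrableOn g' disk := hg'.integrable one_le_two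
    have hmul : ∀ (f : ℂ → F) (φ : ℂ → ℝ), MeasureTheory.IntegrableOn f disk → Continuous φ →
        HasCompactSupport φ → MeasureTheory.IntegrableOn (fun z => φ z • f z) disk := by
      intro f φ hf hφ hc
      obtain ⟨C, hC⟩ := hc.exists_bound_of_continuous hφ
      exact MeasureTheory.Integrable.bdd_smul hf C hφ.aestronglyMeasurable
        (Filter.Eventually.of_forall hC)
    have := IsOpen.ae_eq_zero_of_integral_contDiff_smul_eq_zero (μ := MeasureTheory.volume)
      (U := disk) Metric.isOpen_ball (f := fun z => g z - g' z)
      ((hi.sub hi').locallyIntegrableOn) (by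
        intro φ hφ hc hs
        have e1 := h φ hφ hc hs
        have e2 := h' φ hφ hc hs
        have e3 : ∫ z in disk, φ z • (g z - g' z) = 0 := by
          simp only [smul_sub]
          rw [MeasureTheory.integral_sub (hmul g φ hi hφ.continuous hc)
            (hmul g' φ hi' hφ.continuous hc), sub_eq_zero]
          exact neg_injective (e1.symm.trans e2)
        rw [← e3]
        refine (MeasureTheory.setIntegral_eq_integral_of_forall_compl_eq_zero ?_).symm
        intro z hz
        rw [image_eq_zero_of_notMem_tsupport (fun hz' => hz (hs hz')), zero_smul])
    rw [MeasureTheory.ae_restrict_iff' Metric.isOpen_ball.measurableSet]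
    filter_upwards [this] with z hz hzd
    exact sub_eq_zero.mp (hz hzd)
  apply le_antisymm
  · exact iInf₂_le (g₁, g₂) hu
  · refine le_iInf₂ fun g hg => le_of_eq ?_
    apply MeasureTheory.lintegral_congr_ae
    filter_upwards [key 1 g₁ g.1 hu.memLp_re hg.memLp_re hu.partial_re hg.partial_re,
      key Complex.I g₂ g.2 hu.memLp_im hg.memLp_im hu.partial_im hg.partial_im] with z h1 h2
    rw [h1, h2]

theorem frame_lt_left {n : ℕ} {i j : Fin n} (h : i < j) : frame n i j i =
    (√2)⁻¹ • (EuclideanSpace.single i (1 : ℝ) + EuclideanSpace.single j (1 : ℝ)) := by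
  simp [frame, h]

theorem frame_lt_right {n : ℕ} {i j : Fin n} (h : i < j) : frame n i j j =
    (√2)⁻¹ • (EuclideanSpace.single i (1 : ℝ) - EuclideanSpace.single j (1 : ℝ)) := by
  simp [frame, h, h.ne']

theorem inner_frame_left {n : ℕ} {i j : Fin n} (h : i < j) (x : E n) :
    inner ℝ (frame n i j i) x = (√2)⁻¹ * (x i + x j) := by
  rw [frame_lt_left h]
  simp [inner_smul_left, inner_add_left, EuclideanSpace.inner_single_left]
  ring

theorem inner_frame_right {n : ℕ} {i j : Fin n} (h : i < j) (x : E n) :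
    inner ℝ (frame n i j j) x = (√2)⁻¹ * (x i - x j) := by
  rw [frame_lt_right h]
  simp [inner_smul_left, inner_sub_left, EuclideanSpace.inner_single_left]

theorem inner_frame_other {n : ℕ} {i j k : Fin n} (h : ¬ (i < j ∧ (k = i ∨ k = j))) (x : E n) :
    inner ℝ (frame n i j k) x = x k := by
  have : frame n i j k = EuclideanSpace.single k (1 : ℝ) := by
    unfold frame
    rw [if_neg (fun h' => h ⟨h'.1, Or.inl h'.2⟩), if_neg (fun h' => h ⟨h'.1, Or.inr h'.2⟩)]
  rw [this]
  simp [EuclideanSpace.inner_single_left]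

/-- Parseval's identity for each of the bases. -/
theorem sum_inner_frame_sq {n : ℕ} (i j : Fin n) (x : E n) :
    ∑ k, (inner ℝ (frame n i j k) x) ^ 2 = ‖x‖ ^ 2 := by
  rw [EuclideanSpace.real_norm_sq_eq]
  by_cases h : i < j
  · have hne : j ≠ i := h.ne'
    rw [← Finset.add_sum_erase _ _ (Finset.mem_univ i), ← Finset.add_sum_erase _ (fun k => x k ^ 2)
      (Finset.mem_univ i),
      ← Finset.add_sum_erase _ _ (Finset.mem_erase.mpr ⟨hne, Finset.mem_univ j⟩),
      ← Finset.add_sum_erase _ (fun k => x k ^ 2) (Finset.mem_erase.mpr ⟨hne, Finset.mem_univ j⟩),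
      inner_frame_left h, inner_frame_right h]
    have : ∑ k ∈ (Finset.univ.erase i).erase j, (inner ℝ (frame n i j k) x) ^ 2 =
        ∑ k ∈ (Finset.univ.erase i).erase j, x k ^ 2 := by
      refine Finset.sum_congr rfl fun k hk => ?_
      simp only [Finset.mem_erase] at hk
      rw [inner_frame_other (by tauto)]
    rw [this, mul_pow, mul_pow, inv_pow, Real.sq_sqrt (by norm_num)]
    ring
  · exact Finset.sum_congr rfl fun k _ => by rw [inner_frame_other (by tauto)]

theorem norm_zeta_sub_sq {n : ℕ} (a b c d : E n) :
    ‖zeta s(a, b) - zeta s(c, d)‖ ^ 2 = ((n : ℝ)⁻¹) ^ 2 * ∑ i, ∑ j, ∑ k,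
      ((min (inner ℝ (frame n i j k) a) (inner ℝ (frame n i j k) b)
        - min (inner ℝ (frame n i j k) c) (inner ℝ (frame n i j k) d)) ^ 2 +
       (max (inner ℝ (frame n i j k) a) (inner ℝ (frame n i j k) b)
        - max (inner ℝ (frame n i j k) c) (inner ℝ (frame n i j k) d)) ^ 2) := by
  rw [EuclideanSpace.real_norm_sq_eq]
  simp only [Fintype.sum_prod_type, Fin.sum_univ_two, Finset.mul_sum]
  refine Finset.sum_congr rfl fun i _ => Finset.sum_congr rfl fun j _ =>
    Finset.sum_congr rfl fun k _ => ?_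
  simp [zeta]
  ring

theorem cost_eq {n : ℕ} (a b c d : E n) :
    ((n : ℝ)⁻¹) ^ 2 * ∑ i, ∑ j, ∑ k,
      ((inner ℝ (frame n i j k) a - inner ℝ (frame n i j k) c) ^ 2 +
       (inner ℝ (frame n i j k) b - inner ℝ (frame n i j k) d) ^ 2)
      = ‖a - c‖ ^ 2 + ‖b - d‖ ^ 2 := by
  simp only [← inner_sub_right, Finset.sum_add_distrib, sum_inner_frame_sq]
  rcases Nat.eq_zero_or_pos n with rfl | hn
  · simp [Subsingleton.elim a c, Subsingleton.elim b d]
  · have : (n : ℝ) ≠ 0 := by positivity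
    simp
    field_simp

theorem sorted_le (a b c d : ℝ) :
    (min a b - min c d) ^ 2 + (max a b - max c d) ^ 2 ≤ (a - c) ^ 2 + (b - d) ^ 2 := by
  rcases le_total a b with h | h <;> rcases le_total c d with h' | h' <;>
    simp only [min_eq_left, min_eq_right, max_eq_left, max_eq_right, h, h'] <;>
    nlinarith [mul_nonneg (sub_nonneg.mpr h) (sub_nonneg.mpr h')]

theorem norm_zeta_sub_sq_le {n : ℕ} (a b c d : E n) :
    ‖zeta s(a, b) - zeta s(c, d)‖ ^ 2 ≤ ‖a - c‖ ^ 2 + ‖b - d‖ ^ 2 := by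
  rw [norm_zeta_sub_sq, ← cost_eq a b c d]
  refine mul_le_mul_of_nonneg_left ?_ (sq_nonneg _)
  exact Finset.sum_le_sum fun i _ => Finset.sum_le_sum fun j _ =>
    Finset.sum_le_sum fun k _ => sorted_le _ _ _ _

/-- The embedding is `1`-Lipschitz. -/
theorem norm_zeta_sub_le {n : ℕ} (S T : A2 n) : ‖zeta S - zeta T‖ ≤ dist2 S T := by
  induction S using Sym2.inductionOn with | _ a b
  induction T using Sym2.inductionOn with | _ c d
  refine le_min ?_ ?_
  · exact Real.le_sqrt_of_sq_le (norm_zeta_sub_sq_le a b c d)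
  · rw [Sym2.eq_swap (a := c)]
    exact Real.le_sqrt_of_sq_le (norm_zeta_sub_sq_le a b d c)

theorem sorted_eq {a b c d δ : ℝ} (hac : |a - c| < δ) (hbd : |b - d| < δ)
    (h : c ≠ d → 2 * δ ≤ |c - d|) :
    (min a b - min c d) ^ 2 + (max a b - max c d) ^ 2 = (a - c) ^ 2 + (b - d) ^ 2 := by
  rw [abs_lt] at hac hbd
  rcases lt_trichotomy c d with hcd | rfl | hcd
  · have := h hcd.ne
    rw [abs_of_neg (by linarith)] at this
    have hab : a ≤ b := by linarith
    simp [hab, hcd.le]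
  · rcases le_total a b with hab | hab
    · simp [hab]
    · simp only [min_eq_right, max_eq_left, hab, le_refl]
      ring
  · have := h hcd.ne'
    rw [abs_of_pos (by linarith)] at this
    have hab : b ≤ a := by linarith
    simp only [min_eq_right, max_eq_left, hab, hcd.le]
    ring

theorem abs_inner_frame_le {n : ℕ} (i j k : Fin n) (x : E n) :
    |inner ℝ (frame n i j k) x| ≤ ‖x‖ := by
  refine abs_le_of_sq_le_sq ?_ (norm_nonneg _)
  rw [← sum_inner_frame_sq i j x]
  exact Finset.single_le_sum (f := fun k => (inner ℝ (frame n i j k) x) ^ 2)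
    (fun _ _ => sq_nonneg _) (Finset.mem_univ k)

/-- The embedding preserves the distance to `T` near each point `T`. -/
theorem exists_norm_zeta_sub_eq {n : ℕ} (T : A2 n) :
    ∃ δ > 0, ∀ S : A2 n, dist2 S T < δ → ‖zeta S - zeta T‖ = dist2 S T := by
  induction T using Sym2.inductionOn with | _ c d
  have ev : ∀ᶠ δ in nhdsWithin (0 : ℝ) (Set.Ioi 0), ∀ p : Fin n × Fin n × Fin n,
      (inner ℝ (frame n p.1 p.2.1 p.2.2) c : ℝ) ≠ inner ℝ (frame n p.1 p.2.1 p.2.2) d →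
      2 * δ ≤ |inner ℝ (frame n p.1 p.2.1 p.2.2) c - inner ℝ (frame n p.1 p.2.1 p.2.2) d| := by
    rw [Filter.eventually_all]
    intro p
    by_cases hp : (inner ℝ (frame n p.1 p.2.1 p.2.2) c : ℝ) = inner ℝ (frame n p.1 p.2.1 p.2.2) d
    · simp [hp]
    · have h0 := abs_pos.mpr (sub_ne_zero.mpr hp)
      have := Ioo_mem_nhdsGT (half_pos h0)
      filter_upwards [this] with δ hδ _
      linarith [hδ.2]
  obtain ⟨δ, hδ, hpos⟩ := (ev.and self_mem_nhdsWithin).exists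
  refine ⟨δ, hpos, fun S hS => ?_⟩
  have main : ∀ a b : E n, √(‖a - c‖ ^ 2 + ‖b - d‖ ^ 2) < δ →
      ‖zeta s(a, b) - zeta s(c, d)‖ = √(‖a - c‖ ^ 2 + ‖b - d‖ ^ 2) := by
    intro a b hab
    have h1 : ‖a - c‖ < δ := lt_of_le_of_lt
      (Real.le_sqrt_of_sq_le (by nlinarith [sq_nonneg ‖b - d‖])) hab
    have h2 : ‖b - d‖ < δ := lt_of_le_of_lt
      (Real.le_sqrt_of_sq_le (by nlinarith [sq_nonneg ‖a - c‖])) hab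
    rw [← Real.sqrt_sq (norm_nonneg (zeta s(a, b) - zeta s(c, d))), norm_zeta_sub_sq,
      ← cost_eq a b c d]
    congr 2
    refine Finset.sum_congr rfl fun i _ => Finset.sum_congr rfl fun j _ =>
      Finset.sum_congr rfl fun k _ => sorted_eq (δ := δ) ?_ ?_ (hδ (i, j, k))
    · rw [← inner_sub_right]
      exact (abs_inner_frame_le i j k _).trans_lt h1
    · rw [← inner_sub_right]
      exact (abs_inner_frame_le i j k _).trans_lt h2
  induction S using Sym2.inductionOn with | _ a b
  have hd : dist2 s(a, b) s(c, d) =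
    min (√(‖a - c‖ ^ 2 + ‖b - d‖ ^ 2)) (√(‖a - d‖ ^ 2 + ‖b - c‖ ^ 2)) := rfl
  rw [hd] at hS ⊢
  rcases le_total (√(‖a - c‖ ^ 2 + ‖b - d‖ ^ 2)) (√(‖a - d‖ ^ 2 + ‖b - c‖ ^ 2)) with h | h
  · rw [min_eq_left h] at hS ⊢
    exact main a b hS
  · rw [min_eq_right h] at hS ⊢
    rw [Sym2.eq_swap (a := a), add_comm]
    rw [add_comm] at hS
    exact main b a hS

theorem sorted_sq (a b c d : ℝ) :
    (min a b - min c d) ^ 2 + (max a b - max c d) ^ 2 =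
      ((a + b - (c + d)) ^ 2 + (|a - b| - |c - d|) ^ 2) / 2 := by
  rcases le_total a b with h | h <;> rcases le_total c d with h' | h' <;>
    simp only [min_eq_left, min_eq_right, max_eq_left, max_eq_right, h, h',
      abs_of_nonneg, abs_of_nonpos, sub_nonneg, sub_nonpos] <;> ring

theorem sum_cross_sq {n : ℕ} (x y : E n) :
    ∑ i, ∑ j, (x i * y j + x j * y i) ^ 2 =
      2 * (‖x‖ ^ 2 * ‖y‖ ^ 2) + 2 * (∑ i, x i * y i) ^ 2 := by
  rw [EuclideanSpace.real_norm_sq_eq, EuclideanSpace.real_norm_sq_eq, sq (∑ i, x i * y i),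
    Finset.sum_mul_sum, Finset.sum_mul_sum]
  have e : ∑ i, ∑ j, x j ^ 2 * y i ^ 2 = ∑ i, ∑ j, x i ^ 2 * y j ^ 2 := Finset.sum_comm
  have : ∀ i j, (x i * y j + x j * y i) ^ 2 =
      x i ^ 2 * y j ^ 2 + x j ^ 2 * y i ^ 2 + 2 * (x i * y i * (x j * y j)) := by
    intro i j; ring
  simp only [this, Finset.sum_add_distrib, e, ← Finset.mul_sum]
  ring


theorem abs_abs_sub_mul_le (p q x y η : ℝ) (hx : |p - q| ≤ x) (hy : |p + q| ≤ y)
    (hη : 0 ≤ η) (h : (|p| - |q|) ^ 2 ≤ η ^ 2) : |(p - q) * (p + q)| ≤ η * (x + y) := by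
  have e1 : (p - q) * (p + q) = (|p| - |q|) * (|p| + |q|) := by
    nlinarith [sq_abs p, sq_abs q]
  have e3 : |p| + |q| ≤ x + y := by
    refine le_trans ?_ (add_le_add hx hy)
    rcases abs_cases p with h1 | h1 <;> rcases abs_cases q with h2 | h2 <;>
      rcases abs_cases (p - q) with h3 | h3 <;> rcases abs_cases (p + q) with h4 | h4 <;>
      linarith
  rw [e1, abs_mul, abs_of_nonneg (by positivity : 0 ≤ |p| + |q|)]
  exact mul_le_mul (abs_le_of_sq_le_sq h hη) e3 (by positivity) hη

theorem norm_mul_norm_le {n : ℕ} (x y : E n) (R : ℝ) (hR : 0 ≤ R)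
    (hprod : ∀ i j k, |inner ℝ (frame n i j k) x * inner ℝ (frame n i j k) y| ≤ R) :
    ‖x‖ * ‖y‖ ≤ 3 * n * R := by
  have hdiag : ∀ i, |x i * y i| ≤ R := by
    intro i
    have := hprod i i i
    rwa [inner_frame_other (by simp), inner_frame_other (by simp)] at this
  have hlt : ∀ i j, i < j → |x i * y j + x j * y i| ≤ 4 * R := by
    intro i j hij
    have h1 := hprod i j i
    rw [inner_frame_left hij, inner_frame_left hij] at h1
    have e : (√2)⁻¹ * (x i + x j) * ((√2)⁻¹ * (y i + y j)) =
        (x i * y i + x j * y j + (x i * y j + x j * y i)) / 2 := by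
      have : (√2)⁻¹ * (√2)⁻¹ = (1 / 2 : ℝ) := by
        rw [← mul_inv, Real.mul_self_sqrt (by norm_num)]; norm_num
      linear_combination (x i + x j) * (y i + y j) * this
    rw [e, abs_le] at h1
    have h2 := abs_le.mp (hdiag i)
    have h3 := abs_le.mp (hdiag j)
    rw [abs_le]
    constructor <;> linarith [h1.1, h1.2, h2.1, h2.2, h3.1, h3.2]
  have hall : ∀ i j, |x i * y j + x j * y i| ≤ 4 * R := by
    intro i j
    rcases lt_trichotomy i j with h | rfl | h
    · exact hlt i j h
    · have h2 := abs_le.mp (hdiag i)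
      rw [abs_le]
      constructor <;> linarith [h2.1, h2.2]
    · rw [add_comm]; exact hlt j i h
  refine abs_le_of_sq_le_sq' ?_ (by positivity) |>.2
  have h1 : ∑ i, ∑ j, (x i * y j + x j * y i) ^ 2 ≤ ∑ i : Fin n, ∑ j : Fin n, (4 * R) ^ 2 := by
    refine Finset.sum_le_sum fun i _ => Finset.sum_le_sum fun j _ => ?_
    rw [← sq_abs]
    exact pow_le_pow_left₀ (abs_nonneg _) (hall i j) 2
  rw [sum_cross_sq] at h1
  simp only [Finset.sum_const, Finset.card_univ, Fintype.card_fin, nsmul_eq_mul] at h1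
  have h2 := sq_nonneg (∑ i, x i * y i)
  have h3 := sq_nonneg ((n : ℝ) * R)
  have e1 : (n : ℝ) * (n * (4 * R) ^ 2) = 16 * (n * R) ^ 2 := by ring
  have e2 : (3 * n * R) ^ 2 = 9 * (n * R) ^ 2 := by ring
  rw [e1] at h1
  rw [e2, mul_pow]
  linarith

theorem min_norm_le {n : ℕ} (P Q : E n) (η : ℝ) (hη : 0 ≤ η)
    (h : ∀ i j k, (|inner ℝ (frame n i j k) P| - |inner ℝ (frame n i j k) Q|) ^ 2 ≤ η ^ 2) :
    min ‖P - Q‖ ‖P + Q‖ ≤ 6 * n * η := by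
  have hxy := norm_mul_norm_le (P - Q) (P + Q) (η * (‖P - Q‖ + ‖P + Q‖)) (by positivity) (by
    intro i j k
    have hx := abs_inner_frame_le i j k (P - Q)
    have hy := abs_inner_frame_le i j k (P + Q)
    rw [inner_sub_right] at hx ⊢
    rw [inner_add_right] at hy ⊢
    exact abs_abs_sub_mul_le _ _ _ _ η hx hy hη (h i j k))
  generalize ‖P - Q‖ = x at *
  generalize ‖P + Q‖ = y at *
  have h2 : 0 ≤ 3 * n * η := by positivity
  rcases le_total x y with hle | hle
  · rw [min_eq_left hle]
    by_contra! hlt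
    have hy : 0 < y := lt_of_lt_of_le (by linarith) hle
    nlinarith [mul_le_mul_of_nonneg_left hle h2, mul_lt_mul_of_pos_right hlt hy]
  · rw [min_eq_right hle]
    by_contra! hlt
    have hx : 0 < x := lt_of_lt_of_le (by linarith) hle
    nlinarith [mul_le_mul_of_nonneg_left hle h2, mul_lt_mul_of_pos_right hlt hx]

/-- The inverse of the embedding is Lipschitz on its image. -/
theorem dist2_le_norm_zeta_sub {n : ℕ} (S T : A2 n) :
    dist2 S T ≤ n * (2 + 12 * n) * ‖zeta S - zeta T‖ := by
  induction S using Sym2.inductionOn with | _ a b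
  induction T using Sym2.inductionOn with | _ c d
  have hd : dist2 s(a, b) s(c, d) =
    min (√(‖a - c‖ ^ 2 + ‖b - d‖ ^ 2)) (√(‖a - d‖ ^ 2 + ‖b - c‖ ^ 2)) := rfl
  rw [hd]
  rcases Nat.eq_zero_or_pos n with rfl | hn
  · simp [Subsingleton.elim a d, Subsingleton.elim b d, Subsingleton.elim c d]
  have hn' : (0 : ℝ) < n := by exact_mod_cast hn
  have hsq := norm_zeta_sub_sq a b c d
  have hε0 : 0 ≤ ‖zeta s(a, b) - zeta s(c, d)‖ := norm_nonneg _
  generalize ‖zeta s(a, b) - zeta s(c, d)‖ = ε at *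
  simp only [sorted_sq, ← inner_add_right, ← inner_sub_right] at hsq
  obtain ⟨f, hf⟩ : ∃ f : Fin n → Fin n → Fin n → ℝ, ∀ i j k, f i j k =
    ((inner ℝ (frame n i j k) (a + b - (c + d))) ^ 2 +
      (|inner ℝ (frame n i j k) (a - b)| - |inner ℝ (frame n i j k) (c - d)|) ^ 2) / 2 :=
    ⟨_, fun _ _ _ => rfl⟩
  simp only [← hf] at hsq
  have hf0 : ∀ i j k, 0 ≤ f i j k := fun i j k => by rw [hf]; positivity
  have htot : ∑ i, ∑ j, ∑ k, f i j k = n ^ 2 * ε ^ 2 := by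
    rw [hsq]
    field_simp
  have hblock : ∀ i j, ∑ k, f i j k ≤ n ^ 2 * ε ^ 2 := by
    intro i j
    rw [← htot]
    refine le_trans ?_ (Finset.single_le_sum (f := fun i => ∑ j, ∑ k, f i j k)
      (fun i _ => Finset.sum_nonneg fun j _ => Finset.sum_nonneg fun k _ => hf0 i j k)
      (Finset.mem_univ i))
    exact Finset.single_le_sum (f := fun j => ∑ k, f i j k)
      (fun j _ => Finset.sum_nonneg fun k _ => hf0 i j k) (Finset.mem_univ j)
  have hone : ∀ i j k, f i j k ≤ n ^ 2 * ε ^ 2 := fun i j k =>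
    (Finset.single_le_sum (f := fun k => f i j k) (fun k _ => hf0 i j k)
      (Finset.mem_univ k)).trans (hblock i j)
  have hε2 : 0 ≤ (n : ℝ) ^ 2 * ε ^ 2 := by positivity
  have hsum : ‖a + b - (c + d)‖ ^ 2 ≤ 2 * (n ^ 2 * ε ^ 2) := by
    let i : Fin n := ⟨0, hn⟩
    rw [← sum_inner_frame_sq i i]
    have : ∑ k, (inner ℝ (frame n i i k) (a + b - (c + d))) ^ 2 ≤ ∑ k, 2 * f i i k := by
      refine Finset.sum_le_sum fun k _ => ?_
      rw [hf]
      linarith [sq_nonneg (|inner ℝ (frame n i i k) (a - b)| - |inner ℝ (frame n i i k) (c - d)|)]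
    rw [← Finset.mul_sum] at this
    linarith [hblock i i]
  have hmin := min_norm_le (a - b) (c - d) (2 * (n * ε)) (by positivity) (by
    intro i j k
    have h1 := hone i j k
    rw [hf] at h1
    have h2 := sq_nonneg (inner ℝ (frame n i j k) (a + b - (c + d)))
    have e : (2 * (n * ε)) ^ 2 = 4 * (n ^ 2 * ε ^ 2) := by ring
    rw [e]
    linarith)
  have par : ∀ p q : E n, ‖p‖ ^ 2 + ‖q‖ ^ 2 = (‖p + q‖ ^ 2 + ‖p - q‖ ^ 2) / 2 := by
    intro p q
    have := parallelogram_law_with_norm ℝ p q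
    linarith
  have key : ∀ p q : E n, p + q = a + b - (c + d) → ‖p - q‖ ≤ 6 * n * (2 * (n * ε)) →
      √(‖p‖ ^ 2 + ‖q‖ ^ 2) ≤ n * (2 + 12 * n) * ε := by
    intro p q hpq hle
    rw [Real.sqrt_le_left (by positivity), par, hpq]
    have h1 := pow_le_pow_left₀ (norm_nonneg _) hle 2
    have e1 : (6 * n * (2 * (n * ε))) ^ 2 = 144 * n ^ 2 * (n ^ 2 * ε ^ 2) := by ring
    have e2 : (n * (2 + 12 * n) * ε) ^ 2 =
      4 * (n ^ 2 * ε ^ 2) + 48 * n * (n ^ 2 * ε ^ 2) + 144 * n ^ 2 * (n ^ 2 * ε ^ 2) := by ring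
    rw [e1] at h1
    rw [e2]
    have h3 : 0 ≤ 48 * n * (n ^ 2 * ε ^ 2) := by positivity
    have h4 : 0 ≤ 144 * n ^ 2 * (n ^ 2 * ε ^ 2) := by positivity
    linarith
  rcases min_le_iff.mp hmin with h | h
  · refine (min_le_left _ _).trans (key (a - c) (b - d) (by abel) ?_)
    rwa [show a - c - (b - d) = a - b - (c - d) by abel]
  · refine (min_le_right _ _).trans (key (a - d) (b - c) (by abel) ?_)
    rwa [show a - d - (b - c) = a - b + (c - d) by abel]

end TwoValued

open TwoValued

namespace TwoValued

open MeasureTheory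

/-! ### The mean of a two-valued function -/

/-- The linear map through which translations act on the image of the embedding. -/
noncomputable def translationMap (n : ℕ) : E n →L[ℝ] EN n :=
  LinearMap.toContinuousLinearMap
    { toFun := fun x => WithLp.toLp 2 fun p => (n : ℝ)⁻¹ * inner ℝ (frame n p.1 p.2.1 p.2.2.1) x
      map_add' := fun x y => by ext p; simp [inner_add_right, mul_add]
      map_smul' := fun c x => by ext p; simp [inner_smul_right]; ring }

theorem translationMap_apply {n : ℕ} (x : E n) (p : Fin n × Fin n × Fin n × Fin 2) :
    translationMap n x p = (n : ℝ)⁻¹ * inner ℝ (frame n p.1 p.2.1 p.2.2.1) x := rfl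

theorem norm_translationMap_sq {n : ℕ} (x : E n) :
    ‖translationMap n x‖ ^ 2 = 2 * ‖x‖ ^ 2 := by
  have h := cost_eq x x 0 0
  simp only [inner_zero_right, sub_zero] at h
  rw [two_mul, ← h, EuclideanSpace.real_norm_sq_eq]
  simp only [Fintype.sum_prod_type, Fin.sum_univ_two, Finset.mul_sum, translationMap_apply]
  refine Finset.sum_congr rfl fun i _ => Finset.sum_congr rfl fun j _ =>
    Finset.sum_congr rfl fun k _ => ?_
  ring

theorem inner_translationMap {n : ℕ} (x y : E n) :
    inner ℝ (translationMap n x) (translationMap n y) = 2 * inner ℝ x y := by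
  have h1 := norm_translationMap_sq (x + y)
  rw [map_add, norm_add_sq_real, norm_add_sq_real, norm_translationMap_sq,
    norm_translationMap_sq] at h1
  linarith

theorem zeta_apply_zero {n : ℕ} (P Q : E n) (i j k : Fin n) : zeta s(P, Q) (i, j, k, 0) =
    (n : ℝ)⁻¹ * min (inner ℝ (frame n i j k) P) (inner ℝ (frame n i j k) Q) := by
  simp [zeta]

theorem zeta_apply_one {n : ℕ} (P Q : E n) (i j k : Fin n) : zeta s(P, Q) (i, j, k, 1) =
    (n : ℝ)⁻¹ * max (inner ℝ (frame n i j k) P) (inner ℝ (frame n i j k) Q) := by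
  simp [zeta]

theorem real_inner_eq_mul (x y : ℝ) : inner ℝ x y = x * y := by
  simp [mul_comm]

theorem inner_translationMap_zeta {n : ℕ} (x P Q : E n) :
    inner ℝ (translationMap n x) (zeta s(P, Q)) = inner ℝ x (P + Q) := by
  have h1 : inner ℝ (translationMap n x) (zeta s(P, Q)) =
      inner ℝ (translationMap n x) (translationMap n ((1 / 2 : ℝ) • (P + Q))) := by
    rw [PiLp.inner_apply, PiLp.inner_apply]
    simp only [Fintype.sum_prod_type, Fin.sum_univ_two, translationMap_apply]
    refine Finset.sum_congr rfl fun i _ => Finset.sum_congr rfl fun j _ =>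
      Finset.sum_congr rfl fun k _ => ?_
    have := min_add_max (inner ℝ (frame n i j k) P) (inner ℝ (frame n i j k) Q)
    rw [zeta_apply_zero, zeta_apply_one]
    simp only [inner_smul_right, inner_add_right, real_inner_eq_mul]
    linear_combination (n : ℝ)⁻¹ ^ 2 * (inner ℝ (frame n i j k) x) * this
  rw [h1, inner_translationMap, inner_smul_right]
  ring

/-- The linear map sending `zeta (⟦P⟧ + ⟦Q⟧)` to the mean of `P` and `Q`. -/
noncomputable def meanMap (n : ℕ) : EN n →L[ℝ] E n :=
  (1 / 2 : ℝ) • ContinuousLinearMap.adjoint (translationMap n)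

theorem inner_meanMap {n : ℕ} (x : E n) (y : EN n) :
    inner ℝ (meanMap n y) x = (1 / 2) * inner ℝ y (translationMap n x) := by
  simp only [meanMap, _root_.smul_apply, inner_smul_left,
    ContinuousLinearMap.adjoint_inner_left]
  simp

theorem meanMap_zeta {n : ℕ} (P Q : E n) : meanMap n (zeta s(P, Q)) = (1 / 2 : ℝ) • (P + Q) := by
  refine ext_inner_right ℝ fun x => ?_
  rw [inner_meanMap, real_inner_comm, inner_translationMap_zeta, inner_smul_left, real_inner_comm]
  simp

theorem meanMap_translationMap {n : ℕ} (x : E n) : meanMap n (translationMap n x) = x := by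
  refine ext_inner_right ℝ fun y => ?_
  rw [inner_meanMap, inner_translationMap]
  ring

theorem zeta_map_add {n : ℕ} (S : A2 n) (v : E n) :
    zeta (S.map fun p => p + v) = zeta S + translationMap n v := by
  induction S using Sym2.inductionOn with | _ a b
  ext p
  rw [Sym2.map_mk, PiLp.add_apply, translationMap_apply]
  by_cases hp : p.2.2.2 = 0
  · simp [zeta, hp, inner_add_right, min_add_add_right, mul_add]
  · simp [zeta, hp, inner_add_right, max_add_add_right, mul_add]

theorem zeta_addFun {n : ℕ} (H : ℂ → A2 n) (f : ℂ → E n) (z : ℂ) :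
    zeta (addFun H f z) = zeta (H z) + translationMap n (f z) :=
  zeta_map_add _ _

theorem norm_add_translationMap_sq {n : ℕ} (G : EN n) (g : E n) :
    ‖G + translationMap n g‖ ^ 2 = ‖G‖ ^ 2 + 4 * inner ℝ (meanMap n G) g + 2 * ‖g‖ ^ 2 := by
  rw [norm_add_sq_real, norm_translationMap_sq, inner_meanMap]
  ring

/-! ### Linearity of weak gradients and traces -/

section Sobolev

variable {F : Type*} [NormedAddCommGroup F] [InnerProductSpace ℝ F]
  {F' : Type*} [NormedAddCommGroup F'] [InnerProductSpace ℝ F']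

instance isFiniteMeasure_restrict_disk : IsFiniteMeasure (volume.restrict disk) :=
  isFiniteMeasure_restrict.mpr (measure_ball_lt_top (μ := volume)).ne

theorem integrableOn_disk_smul {𝕜 V : Type*} [NormedAddCommGroup V] [NormedSpace ℝ V]
    [NormedRing 𝕜] [Module 𝕜 V] [IsBoundedSMul 𝕜 V]
    {u : ℂ → V} {φ : ℂ → 𝕜} (hu : IntegrableOn u disk) (hφ : Continuous φ) :
    IntegrableOn (fun z => φ z • u z) disk := by
  obtain ⟨C, hC⟩ := (isCompact_closedBall (0 : ℂ) 1).exists_bound_of_continuousOn hφ.continuousOn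
  refine Integrable.bdd_smul hu C hφ.aestronglyMeasurable ?_
  filter_upwards [ae_restrict_mem Metric.isOpen_ball.measurableSet] with z hz
  exact hC z (Metric.ball_subset_closedBall hz)

theorem _root_.MeasureTheory.MemLp.integrableOn_disk {V : Type*} [NormedAddCommGroup V] {u : ℂ → V}
    (hu : MemLp u 2 (volume.restrict disk)) : IntegrableOn u disk :=
  hu.integrable one_le_two

theorem continuous_fderiv_apply {φ : ℂ → F} {k : WithTop ℕ∞} (hk : k ≠ 0) (hφ : ContDiff ℝ k φ)
    (v : ℂ) : Continuous fun z => fderiv ℝ φ z v :=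
  (hφ.continuous_fderiv hk).clm_apply continuous_const

theorem HasWeakPartial.add {u u' g g' : ℂ → F} {v : ℂ} (hu : IntegrableOn u disk)
    (hu' : IntegrableOn u' disk) (hg : IntegrableOn g disk) (hg' : IntegrableOn g' disk)
    (h : HasWeakPartial u g v) (h' : HasWeakPartial u' g' v) :
    HasWeakPartial (fun z => u z + u' z) (fun z => g z + g' z) v := by
  intro φ hφ hc hs
  have c1 := continuous_fderiv_apply (by simp) hφ v
  simp only [smul_add]
  rw [integral_add (integrableOn_disk_smul hu c1) (integrableOn_disk_smul hu' c1),
    integral_add (integrableOn_disk_smul hg hφ.continuous)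
      (integrableOn_disk_smul hg' hφ.continuous), h φ hφ hc hs, h' φ hφ hc hs, neg_add]

theorem HasWeakPartial.clm_comp [CompleteSpace F] [CompleteSpace F'] (A : F →L[ℝ] F') {u g : ℂ → F} {v : ℂ}
    (hu : IntegrableOn u disk) (hg : IntegrableOn g disk) (h : HasWeakPartial u g v) :
    HasWeakPartial (fun z => A (u z)) (fun z => A (g z)) v := by
  intro φ hφ hc hs
  have c1 := continuous_fderiv_apply (by simp) hφ v
  simp only [← map_smul]
  rw [A.integral_comp_comm (integrableOn_disk_smul hu c1),
    A.integral_comp_comm (integrableOn_disk_smul hg hφ.continuous), h φ hφ hc hs, map_neg]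

theorem IsWeakGradient.add {u g₁ g₂ u' g₁' g₂' : ℂ → F} (h : IsWeakGradient u g₁ g₂)
    (h' : IsWeakGradient u' g₁' g₂') :
    IsWeakGradient (fun z => u z + u' z) (fun z => g₁ z + g₁' z) (fun z => g₂ z + g₂' z) where
  memLp := h.memLp.add h'.memLp
  memLp_re := h.memLp_re.add h'.memLp_re
  memLp_im := h.memLp_im.add h'.memLp_im
  partial_re := h.partial_re.add h.memLp.integrableOn_disk h'.memLp.integrableOn_disk
    h.memLp_re.integrableOn_disk h'.memLp_re.integrableOn_disk h'.partial_re
  partial_im := h.partial_im.add h.memLp.integrableOn_disk h'.memLp.integrableOn_disk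
    h.memLp_im.integrableOn_disk h'.memLp_im.integrableOn_disk h'.partial_im

theorem IsWeakGradient.clm_comp [CompleteSpace F] [CompleteSpace F'] (A : F →L[ℝ] F')
    {u g₁ g₂ : ℂ → F} (h : IsWeakGradient u g₁ g₂) :
    IsWeakGradient (fun z => A (u z)) (fun z => A (g₁ z)) (fun z => A (g₂ z)) where
  memLp := A.comp_memLp' h.memLp
  memLp_re := A.comp_memLp' h.memLp_re
  memLp_im := A.comp_memLp' h.memLp_im
  partial_re := h.partial_re.clm_comp A h.memLp.integrableOn_disk h.memLp_re.integrableOn_disk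
  partial_im := h.partial_im.clm_comp A h.memLp.integrableOn_disk h.memLp_im.integrableOn_disk

theorem IsWeakGradient.congr_ae {u u' g₁ g₂ : ℂ → F} (h : IsWeakGradient u g₁ g₂)
    (hu : u =ᵐ[volume.restrict disk] u') : IsWeakGradient u' g₁ g₂ where
  memLp := (memLp_congr_ae hu).mp h.memLp
  memLp_re := h.memLp_re
  memLp_im := h.memLp_im
  partial_re := fun φ hφ hc hs => by
    rw [← h.partial_re φ hφ hc hs]
    refine integral_congr_ae ?_
    filter_upwards [hu] with z hz
    rw [hz]
  partial_im := fun φ hφ hc hs => by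
    rw [← h.partial_im φ hφ hc hs]
    refine integral_congr_ae ?_
    filter_upwards [hu] with z hz
    rw [hz]

/-- `u` is in `W^{1,2}` of the disk with weak gradient `(g₁, g₂)` and trace `t`. -/
structure IsTraceGradient (u g₁ g₂ : ℂ → F) (t : Circle → F) : Prop where
  isWeakGradient : IsWeakGradient u g₁ g₂
  memLp_trace : MemLp (fun θ : ℝ => t (Circle.exp θ)) 2
    (volume.restrict (Set.Ioc 0 (2 * Real.pi)))
  green : ∀ φ₁ φ₂ : ℂ → ℝ, ContDiff ℝ 1 φ₁ → ContDiff ℝ 1 φ₂ →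
      ∫ z in disk, (fderiv ℝ φ₁ z 1 + fderiv ℝ φ₂ z Complex.I) • u z =
        -(∫ z in disk, (φ₁ z • g₁ z + φ₂ z • g₂ z)) +
        ∫ θ in (0 : ℝ)..(2 * Real.pi),
          (φ₁ (Circle.exp θ) * Real.cos θ + φ₂ (Circle.exp θ) * Real.sin θ) • t (Circle.exp θ)

theorem IsTraceGradient.hasTrace {u g₁ g₂ : ℂ → F} {t : Circle → F}
    (h : IsTraceGradient u g₁ g₂ t) : HasTrace u t :=
  ⟨h.memLp_trace, g₁, g₂, h.isWeakGradient, h.green⟩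

theorem HasTrace.exists_isTraceGradient {u : ℂ → F} {t : Circle → F} (h : HasTrace u t) :
    ∃ g₁ g₂, IsTraceGradient u g₁ g₂ t := by
  obtain ⟨ht, g₁, g₂, hg, hgreen⟩ := h
  exact ⟨g₁, g₂, hg, ht, hgreen⟩

theorem intervalIntegrable_circle_smul {t : Circle → F}
    (ht : MemLp (fun θ : ℝ => t (Circle.exp θ)) 2 (volume.restrict (Set.Ioc 0 (2 * Real.pi))))
    {φ₁ φ₂ : ℂ → ℝ} (hφ₁ : Continuous φ₁) (hφ₂ : Continuous φ₂) :
    IntervalIntegrable (fun θ : ℝ => (φ₁ (Circle.exp θ) * Real.cos θ +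
      φ₂ (Circle.exp θ) * Real.sin θ) • t (Circle.exp θ)) volume 0 (2 * Real.pi) := by
  have h1 : IntervalIntegrable (fun θ : ℝ => t (Circle.exp θ)) volume 0 (2 * Real.pi) := by
    rw [intervalIntegrable_iff_integrableOn_Ioc_of_le Real.two_pi_pos.le]
    exact ht.integrable one_le_two
  refine h1.continuousOn_smul ?_
  have : Continuous fun θ : ℝ => (Circle.exp θ : ℂ) :=
    continuous_subtype_val.comp Circle.exp.continuous
  fun_prop

theorem IsTraceGradient.add {u g₁ g₂ u' g₁' g₂' : ℂ → F} {t t' : Circle → F}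
    (h : IsTraceGradient u g₁ g₂ t) (h' : IsTraceGradient u' g₁' g₂' t') :
    IsTraceGradient (fun z => u z + u' z) (fun z => g₁ z + g₁' z) (fun z => g₂ z + g₂' z)
      (fun z => t z + t' z) where
  isWeakGradient := h.isWeakGradient.add h'.isWeakGradient
  memLp_trace := h.memLp_trace.add h'.memLp_trace
  green := by
    intro φ₁ φ₂ hφ₁ hφ₂
    have c : Continuous fun z => fderiv ℝ φ₁ z 1 + fderiv ℝ φ₂ z Complex.I :=
      (continuous_fderiv_apply one_ne_zero hφ₁ 1).add
        (continuous_fderiv_apply one_ne_zero hφ₂ Complex.I)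
    have hi : ∀ {v p₁ p₂ : ℂ → F}, IsWeakGradient v p₁ p₂ →
        IntegrableOn (fun z => φ₁ z • p₁ z + φ₂ z • p₂ z) disk := fun hv =>
      (integrableOn_disk_smul hv.memLp_re.integrableOn_disk hφ₁.continuous).add
        (integrableOn_disk_smul hv.memLp_im.integrableOn_disk hφ₂.continuous)
    have e : ∀ z, φ₁ z • (g₁ z + g₁' z) + φ₂ z • (g₂ z + g₂' z) =
        (φ₁ z • g₁ z + φ₂ z • g₂ z) + (φ₁ z • g₁' z + φ₂ z • g₂' z) := fun z => by
      simp only [smul_add]; abel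
    simp only [e]
    rw [integral_add (hi h.isWeakGradient) (hi h'.isWeakGradient)]
    simp only [smul_add (_ + _ : ℝ)]
    rw [integral_add (integrableOn_disk_smul h.isWeakGradient.memLp.integrableOn_disk c)
        (integrableOn_disk_smul h'.isWeakGradient.memLp.integrableOn_disk c),
      intervalIntegral.integral_add
        (intervalIntegrable_circle_smul h.memLp_trace hφ₁.continuous hφ₂.continuous)
        (intervalIntegrable_circle_smul h'.memLp_trace hφ₁.continuous hφ₂.continuous),
      h.green φ₁ φ₂ hφ₁ hφ₂, h'.green φ₁ φ₂ hφ₁ hφ₂]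
    abel

theorem IsTraceGradient.clm_comp [CompleteSpace F] [CompleteSpace F'] (A : F →L[ℝ] F')
    {u g₁ g₂ : ℂ → F} {t : Circle → F} (h : IsTraceGradient u g₁ g₂ t) :
    IsTraceGradient (fun z => A (u z)) (fun z => A (g₁ z)) (fun z => A (g₂ z))
      (fun z => A (t z)) where
  isWeakGradient := h.isWeakGradient.clm_comp A
  memLp_trace := A.comp_memLp' h.memLp_trace
  green := by
    intro φ₁ φ₂ hφ₁ hφ₂
    have c : Continuous fun z => fderiv ℝ φ₁ z 1 + fderiv ℝ φ₂ z Complex.I :=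
      (continuous_fderiv_apply one_ne_zero hφ₁ 1).add
        (continuous_fderiv_apply one_ne_zero hφ₂ Complex.I)
    simp only [← map_smul, ← map_add]
    have hi : IntegrableOn (fun z => φ₁ z • g₁ z + φ₂ z • g₂ z) disk :=
      (integrableOn_disk_smul h.isWeakGradient.memLp_re.integrableOn_disk hφ₁.continuous).add
        (integrableOn_disk_smul h.isWeakGradient.memLp_im.integrableOn_disk hφ₂.continuous)
    rw [A.integral_comp_comm (integrableOn_disk_smul h.isWeakGradient.memLp.integrableOn_disk c),
      A.integral_comp_comm hi,
      A.intervalIntegral_comp_comm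
        (intervalIntegrable_circle_smul h.memLp_trace hφ₁.continuous hφ₂.continuous),
      h.green φ₁ φ₂ hφ₁ hφ₂, map_add, map_neg]

/-! ### The energy as a real integral -/

theorem integrableOn_energy {V : Type*} [NormedAddCommGroup V] {g₁ g₂ : ℂ → V}
    (h₁ : MemLp g₁ 2 (volume.restrict disk))
    (h₂ : MemLp g₂ 2 (volume.restrict disk)) :
    IntegrableOn (fun z => ‖g₁ z‖ ^ 2 + ‖g₂ z‖ ^ 2) disk :=
  h₁.integrable_norm_pow'.add h₂.integrable_norm_pow'

theorem IsWeakGradient.dir_eq_ofReal [CompleteSpace F] {u g₁ g₂ : ℂ → F} (h : IsWeakGradient u g₁ g₂) :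
    dir u = ENNReal.ofReal (∫ z in disk, (‖g₁ z‖ ^ 2 + ‖g₂ z‖ ^ 2)) := by
  rw [dir_eq h, ofReal_integral_eq_lintegral_ofReal (integrableOn_energy h.memLp_re h.memLp_im)
    (Filter.Eventually.of_forall fun z => by positivity)]
  refine lintegral_congr fun z => ?_
  rw [ENNReal.ofReal_add (by positivity) (by positivity), ENNReal.ofReal_pow (norm_nonneg _),
    ENNReal.ofReal_pow (norm_nonneg _), ofReal_norm, ofReal_norm]

theorem dir_eq_top {u : ℂ → F} (h : ¬ MemW12 u) : dir u = ⊤ := by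
  simp only [dir, iInf_eq_top]
  exact fun g hg => absurd ⟨g.1, g.2, hg⟩ h

end Sobolev

/-! ### The divergence theorem for functions vanishing on the circle -/

theorem integrableOn_disk_of_continuous {V : Type*} [NormedAddCommGroup V] {f : ℂ → V}
    (hf : Continuous f) : IntegrableOn f disk :=
  (hf.continuousOn.integrableOn_compact (isCompact_closedBall (0 : ℂ) 1)).mono_set
    Metric.ball_subset_closedBall

theorem memLp_disk_of_continuous {V : Type*} [NormedAddCommGroup V] {f : ℂ → V}
    (hf : Continuous f) (p : ENNReal) : MemLp f p (volume.restrict disk) := by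
  obtain ⟨C, hC⟩ := (isCompact_closedBall (0 : ℂ) 1).exists_bound_of_continuousOn hf.continuousOn
  refine MemLp.of_bound (integrableOn_disk_of_continuous hf).aestronglyMeasurable C ?_
  filter_upwards [ae_restrict_mem Metric.isOpen_ball.measurableSet] with z hz
  exact hC z (Metric.ball_subset_closedBall hz)

theorem setIntegral_fderiv_one_eq_zero {g : ℂ → ℝ} (hg : ContDiff ℝ 1 g)
    (h0 : ∀ z : ℂ, ‖z‖ = 1 → g z = 0) : ∫ z in disk, fderiv ℝ g z 1 = 0 := by
  have hc : Continuous fun z => fderiv ℝ g z 1 := continuous_fderiv_apply one_ne_zero hg 1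
  have hi : Integrable (disk.indicator fun z => fderiv ℝ g z 1) :=
    (integrable_indicator_iff Metric.isOpen_ball.measurableSet).mpr
      (integrableOn_disk_of_continuous hc)
  have mp := Complex.volume_preserving_equiv_real_prod.symm
  have hi' : Integrable fun p : ℝ × ℝ => disk.indicator (fun z => fderiv ℝ g z 1)
      (Complex.measurableEquivRealProd.symm p) :=
    (mp.integrable_comp_emb Complex.measurableEquivRealProd.symm.measurableEmbedding).mpr hi
  rw [Measure.volume_eq_prod] at hi'
  rw [← integral_indicator Metric.isOpen_ball.measurableSet,
    ← mp.integral_comp Complex.measurableEquivRealProd.symm.measurableEmbedding,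
    Measure.volume_eq_prod, integral_prod_symm _ hi']
  refine integral_eq_zero_of_ae (Filter.Eventually.of_forall fun y => ?_)
  simp only [Complex.measurableEquivRealProd_symm_apply, Pi.zero_apply]
  have hnorm : ∀ x : ℝ, ‖(⟨x, y⟩ : ℂ)‖ ^ 2 = x ^ 2 + y ^ 2 := fun x => by
    rw [← Complex.normSq_eq_norm_sq, Complex.normSq_mk]; ring
  have hmem : ∀ x : ℝ, (⟨x, y⟩ : ℂ) ∈ disk ↔ x ^ 2 < 1 - y ^ 2 := fun x => by
    rw [Metric.mem_ball, dist_zero_right, ← abs_of_nonneg (norm_nonneg (⟨x, y⟩ : ℂ)),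
      ← sq_lt_one_iff_abs_lt_one, hnorm]
    constructor <;> intro h <;> linarith
  rcases le_or_gt (1 - y ^ 2) 0 with hy | hy
  · refine integral_eq_zero_of_ae (Filter.Eventually.of_forall fun x => ?_)
    refine Set.indicator_of_notMem ?_ _
    rw [hmem]
    nlinarith [sq_nonneg x]
  · set s := √(1 - y ^ 2)
    have hs : 0 < s := Real.sqrt_pos.mpr hy
    have hs2 : s ^ 2 = 1 - y ^ 2 := Real.sq_sqrt hy.le
    have e : (fun x : ℝ => disk.indicator (fun z => fderiv ℝ g z 1) (⟨x, y⟩ : ℂ)) =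
        (Set.Ioo (-s) s).indicator fun x : ℝ => fderiv ℝ g (⟨x, y⟩ : ℂ) 1 := by
      funext x
      have : (⟨x, y⟩ : ℂ) ∈ disk ↔ x ∈ Set.Ioo (-s) s := by
        rw [hmem, ← hs2, Set.mem_Ioo, ← abs_lt, sq_lt_sq, abs_of_pos hs]
      by_cases hx : x ∈ Set.Ioo (-s) s
      · rw [Set.indicator_of_mem hx, Set.indicator_of_mem (this.mpr hx)]
      · rw [Set.indicator_of_notMem hx, Set.indicator_of_notMem (mt this.mp hx)]
    have hcurve : ∀ x : ℝ, HasDerivAt (fun x : ℝ => (⟨x, y⟩ : ℂ)) 1 x := by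
      intro x
      have h1 := (Complex.ofRealCLM.hasDerivAt (x := x)).add_const (y * Complex.I)
      simp only [Complex.ofRealCLM_apply, Complex.ofReal_one] at h1
      refine h1.congr_of_eventuallyEq (Filter.Eventually.of_forall fun t => ?_)
      exact Complex.mk_eq_add_mul_I t y
    have hcc : Continuous fun x : ℝ => (⟨x, y⟩ : ℂ) :=
      continuous_iff_continuousAt.mpr fun x => (hcurve x).continuousAt
    rw [e, integral_indicator measurableSet_Ioo, ← integral_Ioc_eq_integral_Ioo,
      ← intervalIntegral.integral_of_le (by linarith),
      intervalIntegral.integral_eq_sub_of_hasDerivAt (f := fun x : ℝ => g ⟨x, y⟩)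
        (fun x _ => ((hg.differentiable one_ne_zero _).hasFDerivAt.comp_hasDerivAt x (hcurve x)))
        ((hc.comp hcc).intervalIntegrable _ _), h0, h0, sub_zero]
    · rw [← pow_eq_one_iff_of_nonneg (norm_nonneg _) two_ne_zero, hnorm, neg_sq, hs2]; ring
    · rw [← pow_eq_one_iff_of_nonneg (norm_nonneg _) two_ne_zero, hnorm, hs2]; ring

theorem setIntegral_fderiv_I_eq_zero {g : ℂ → ℝ} (hg : ContDiff ℝ 1 g)
    (h0 : ∀ z : ℂ, ‖z‖ = 1 → g z = 0) : ∫ z in disk, fderiv ℝ g z Complex.I = 0 := by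
  let ρ : ℂ ≃ₗᵢ[ℝ] ℂ := rotation ⟨Complex.I, by simp [Submonoid.unitSphere]⟩
  have hρ : ∀ z, ρ z = Complex.I * z := fun z => rfl
  have h1 := setIntegral_fderiv_one_eq_zero (g := fun z => g (ρ z))
    (hg.comp ρ.toContinuousLinearEquiv.contDiff) fun z hz => h0 _ (by rw [ρ.norm_map, hz])
  have e : ∀ z, fderiv ℝ (fun z => g (ρ z)) z 1 = fderiv ℝ g (ρ z) Complex.I := by
    intro z
    have := (hg.differentiable one_ne_zero (ρ z)).hasFDerivAt.comp z
      ρ.toContinuousLinearEquiv.hasFDerivAt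
    rw [show (fun z => g (ρ z)) = g ∘ ρ from rfl, HasFDerivAt.fderiv this]
    change fderiv ℝ g (ρ z) (ρ 1) = _
    rw [hρ 1, mul_one]
  simp only [e] at h1
  rw [← h1, ← ρ.measurePreserving.setIntegral_preimage_emb
    ρ.toHomeomorph.measurableEmbedding (fun z => fderiv ℝ g z Complex.I) disk]
  congr 2
  ext z
  simp

theorem setIntegral_fderiv_mul_eq_neg {φ w : ℂ → ℝ} (hφ : ContDiff ℝ 1 φ) (hw : ContDiff ℝ 1 w)
    (h0 : ∀ z : ℂ, ‖z‖ = 1 → φ z * w z = 0) {v : ℂ} (hv : v = 1 ∨ v = Complex.I) :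
    ∫ z in disk, fderiv ℝ φ z v * w z = -∫ z in disk, φ z * fderiv ℝ w z v := by
  have h : ∫ z in disk, fderiv ℝ (fun z => φ z * w z) z v = 0 := by
    rcases hv with rfl | rfl
    · exact setIntegral_fderiv_one_eq_zero (hφ.mul hw) h0
    · exact setIntegral_fderiv_I_eq_zero (hφ.mul hw) h0
  have e : ∀ z, fderiv ℝ (fun z => φ z * w z) z v =
      φ z * fderiv ℝ w z v + fderiv ℝ φ z v * w z := fun z => by
    rw [fderiv_fun_mul (hφ.differentiable one_ne_zero z) (hw.differentiable one_ne_zero z)]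
    simp [mul_comm]
  simp only [e] at h
  have cw := continuous_fderiv_apply one_ne_zero hw v
  have cφ := continuous_fderiv_apply one_ne_zero hφ v
  have hw' := hw.continuous
  have hφ' := hφ.continuous
  rw [integral_add (integrableOn_disk_of_continuous (by fun_prop))
    (integrableOn_disk_of_continuous (by fun_prop))] at h
  linarith

theorem hasWeakPartial_fderiv {w : ℂ → ℝ} (hw : ContDiff ℝ 1 w) {v : ℂ}
    (hv : v = 1 ∨ v = Complex.I) : HasWeakPartial w (fun z => fderiv ℝ w z v) v := by
  intro φ hφ _ hs
  refine setIntegral_fderiv_mul_eq_neg (hφ.of_le (by exact_mod_cast le_top)) hw ?_ hv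
  intro z hz
  have hz' : z ∉ tsupport φ := fun h => by
    have := hs h
    rw [Metric.mem_ball, dist_zero_right, hz] at this
    exact lt_irrefl _ this
  rw [image_eq_zero_of_notMem_tsupport hz', zero_mul]

theorem isTraceGradient_of_eq_zero {w : ℂ → ℝ} (hw : ContDiff ℝ 1 w)
    (h0 : ∀ z : ℂ, ‖z‖ = 1 → w z = 0) :
    IsTraceGradient w (fun z => fderiv ℝ w z 1) (fun z => fderiv ℝ w z Complex.I)
      (fun _ => 0) where
  isWeakGradient :=
    { memLp := memLp_disk_of_continuous hw.continuous 2
      memLp_re := memLp_disk_of_continuous (continuous_fderiv_apply one_ne_zero hw _) 2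
      memLp_im := memLp_disk_of_continuous (continuous_fderiv_apply one_ne_zero hw _) 2
      partial_re := hasWeakPartial_fderiv hw (Or.inl rfl)
      partial_im := hasWeakPartial_fderiv hw (Or.inr rfl) }
  memLp_trace := MemLp.zero
  green := by
    intro φ₁ φ₂ hφ₁ hφ₂
    have c1 := continuous_fderiv_apply one_ne_zero hφ₁ 1
    have c2 := continuous_fderiv_apply one_ne_zero hφ₂ Complex.I
    have c3 := continuous_fderiv_apply one_ne_zero hw 1
    have c4 := continuous_fderiv_apply one_ne_zero hw Complex.I
    simp only [smul_eq_mul, mul_zero, intervalIntegral.integral_zero, add_zero, add_mul]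
    have hw' := hw.continuous
    have hφ₁' := hφ₁.continuous
    have hφ₂' := hφ₂.continuous
    rw [integral_add (integrableOn_disk_of_continuous (by fun_prop))
        (integrableOn_disk_of_continuous (by fun_prop)),
      integral_add (integrableOn_disk_of_continuous (by fun_prop))
        (integrableOn_disk_of_continuous (by fun_prop)),
      setIntegral_fderiv_mul_eq_neg hφ₁ hw (fun z hz => by rw [h0 z hz, mul_zero]) (Or.inl rfl),
      setIntegral_fderiv_mul_eq_neg hφ₂ hw (fun z hz => by rw [h0 z hz, mul_zero]) (Or.inr rfl)]
    ring

/-! ### The Euler-Lagrange equation for the mean of a minimizer -/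

theorem _root_.MeasureTheory.MemLp.integrable_real_inner {V α : Type*} [NormedAddCommGroup V]
    [InnerProductSpace ℝ V] [MeasurableSpace α] {μ : Measure α} {f g : α → V}
    (hf : MemLp f 2 μ) (hg : MemLp g 2 μ) : Integrable (fun z => (inner ℝ (f z) (g z) : ℝ)) μ := by
  refine Integrable.mono' ((hf.integrable_norm_pow two_ne_zero).add
    (hg.integrable_norm_pow two_ne_zero)) (hf.aestronglyMeasurable.inner hg.aestronglyMeasurable)
    (Filter.Eventually.of_forall fun z => ?_)
  have h1 := norm_inner_le_norm (𝕜 := ℝ) (f z) (g z)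
  simp only [Pi.add_apply]
  nlinarith [sq_nonneg (‖f z‖ - ‖g z‖), sq_nonneg (‖f z‖ + ‖g z‖)]

section Energy

variable {n : ℕ} {H : ℂ → A2 n} {G₁ G₂ : ℂ → EN n} {f g₁ g₂ : ℂ → E n}

theorem isWeakGradient_zeta_addFun (hG : IsWeakGradient (fun z => zeta (H z)) G₁ G₂)
    (hg : IsWeakGradient f g₁ g₂) :
    IsWeakGradient (fun z => zeta (addFun H f z)) (fun z => G₁ z + translationMap n (g₁ z))
      (fun z => G₂ z + translationMap n (g₂ z)) := by
  simp only [zeta_addFun]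
  exact hG.add (hg.clm_comp (translationMap n))

theorem integral_energy_add_translationMap (hG₁ : MemLp G₁ 2 (volume.restrict disk))
    (hG₂ : MemLp G₂ 2 (volume.restrict disk)) (hg₁ : MemLp g₁ 2 (volume.restrict disk))
    (hg₂ : MemLp g₂ 2 (volume.restrict disk)) :
    ∫ z in disk, (‖G₁ z + translationMap n (g₁ z)‖ ^ 2 + ‖G₂ z + translationMap n (g₂ z)‖ ^ 2) =
      (∫ z in disk, (‖G₁ z‖ ^ 2 + ‖G₂ z‖ ^ 2)) +
      4 * (∫ z in disk, (inner ℝ (meanMap n (G₁ z)) (g₁ z) + inner ℝ (meanMap n (G₂ z)) (g₂ z))) +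
      2 * ∫ z in disk, (‖g₁ z‖ ^ 2 + ‖g₂ z‖ ^ 2) := by
  have i1 := integrableOn_energy hG₁ hG₂
  have i2 := integrableOn_energy hg₁ hg₂
  have i3 : IntegrableOn (fun z => (inner ℝ (meanMap n (G₁ z)) (g₁ z) +
      inner ℝ (meanMap n (G₂ z)) (g₂ z) : ℝ)) disk :=
    (((meanMap n).comp_memLp' hG₁).integrable_real_inner hg₁).add
      (((meanMap n).comp_memLp' hG₂).integrable_real_inner hg₂)
  have i4 : IntegrableOn (fun z => ‖G₁ z‖ ^ 2 + ‖G₂ z‖ ^ 2 +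
      4 * (inner ℝ (meanMap n (G₁ z)) (g₁ z) + inner ℝ (meanMap n (G₂ z)) (g₂ z))) disk :=
    i1.add (i3.const_mul 4)
  rw [← integral_const_mul, ← integral_const_mul, ← integral_add i1 (i3.const_mul 4),
    ← integral_add i4 (i2.const_mul 2)]
  congr 1
  funext z
  rw [norm_add_translationMap_sq, norm_add_translationMap_sq]
  ring

/-- The energy of `H + f` in terms of the gradients of `H` and `f`. -/
theorem dirA2_addFun (hG : IsWeakGradient (fun z => zeta (H z)) G₁ G₂)
    (hg : IsWeakGradient f g₁ g₂) :
    dirA2 (addFun H f) = ENNReal.ofReal ((∫ z in disk, (‖G₁ z‖ ^ 2 + ‖G₂ z‖ ^ 2)) +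
      4 * (∫ z in disk, (inner ℝ (meanMap n (G₁ z)) (g₁ z) + inner ℝ (meanMap n (G₂ z)) (g₂ z))) +
      2 * ∫ z in disk, (‖g₁ z‖ ^ 2 + ‖g₂ z‖ ^ 2)) := by
  rw [dirA2, (isWeakGradient_zeta_addFun hG hg).dir_eq_ofReal,
    integral_energy_add_translationMap hG.memLp_re hG.memLp_im hg.memLp_re hg.memLp_im]

theorem IsDirMinimizing.integral_inner_eq_zero {T : Circle → EN n} (hH : IsDirMinimizing H)
    (hG : IsTraceGradient (fun z => zeta (H z)) G₁ G₂ T)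
    (hg : IsTraceGradient f g₁ g₂ fun _ => 0) :
    ∫ z in disk, (inner ℝ (meanMap n (G₁ z)) (g₁ z) + inner ℝ (meanMap n (G₂ z)) (g₂ z)) = 0 := by
  set I := ∫ z in disk, (inner ℝ (meanMap n (G₁ z)) (g₁ z) + inner ℝ (meanMap n (G₂ z)) (g₂ z))
    with hI
  set Q := ∫ z in disk, (‖g₁ z‖ ^ 2 + ‖g₂ z‖ ^ 2) with hQ
  have hQ0 : 0 ≤ Q := integral_nonneg fun z => by positivity
  have key : ∀ t : ℝ, 0 ≤ 4 * (t * I) + 2 * (t ^ 2 * Q) := by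
    intro t
    have ht : IsTraceGradient (fun z => t • f z) (fun z => t • g₁ z) (fun z => t • g₂ z)
        fun _ => 0 := by
      have := hg.clm_comp (t • ContinuousLinearMap.id ℝ (E n))
      simpa using this
    have hadd : IsTraceGradient (fun z => zeta (addFun H (fun z => t • f z) z))
        (fun z => G₁ z + translationMap n (t • g₁ z)) (fun z => G₂ z + translationMap n (t • g₂ z))
        T := by
      simp only [zeta_addFun]
      simpa only [map_zero, add_zero] using hG.add (ht.clm_comp (translationMap n))
    have hle := hH.2 (addFun H fun z => t • f z) ⟨_, _, hadd.isWeakGradient⟩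
      ⟨T, hG.hasTrace, hadd.hasTrace⟩
    rw [dirA2_addFun hG.isWeakGradient ht.isWeakGradient, dirA2,
      hG.isWeakGradient.dir_eq_ofReal] at hle
    have e1 : ∫ z in disk, (inner ℝ (meanMap n (G₁ z)) (t • g₁ z) +
        inner ℝ (meanMap n (G₂ z)) (t • g₂ z)) = t * I := by
      rw [hI, ← integral_const_mul]
      simp only [inner_smul_right, mul_add]
    have e2 : ∫ z in disk, (‖t • g₁ z‖ ^ 2 + ‖t • g₂ z‖ ^ 2) = t ^ 2 * Q := by
      rw [hQ, ← integral_const_mul]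
      simp only [norm_smul, mul_pow, mul_add, Real.norm_eq_abs, sq_abs]
    rw [e1, e2] at hle
    have hE := integral_energy_add_translationMap hG.isWeakGradient.memLp_re
      hG.isWeakGradient.memLp_im ht.isWeakGradient.memLp_re ht.isWeakGradient.memLp_im
    rw [e1, e2] at hE
    rw [ENNReal.ofReal_le_ofReal_iff (hE ▸ integral_nonneg fun z => by positivity)] at hle
    linarith
  by_contra hne
  have h1 := key (-I / (Q + 1))
  have h2 : 4 * (-I / (Q + 1) * I) + 2 * ((-I / (Q + 1)) ^ 2 * Q) =
      -(2 * I ^ 2 * (Q + 2)) / (Q + 1) ^ 2 := by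
    field_simp
    ring
  rw [h2] at h1
  have h3 : 0 < 2 * I ^ 2 * (Q + 2) / (Q + 1) ^ 2 := by positivity
  rw [neg_div] at h1
  linarith

end Energy

/-! ### Functions on the disk with vanishing moments -/

/-- The radial retraction of the plane onto the closed unit disk. -/
noncomputable def diskRetraction (z : ℂ) : Metric.closedBall (0 : ℂ) 1 :=
  ⟨(max 1 ‖z‖)⁻¹ • z, by
    rw [mem_closedBall_zero_iff, norm_smul, norm_inv, Real.norm_of_nonneg (by positivity),
      inv_mul_le_iff₀ (by positivity), mul_one]
    exact le_max_right _ _⟩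

theorem continuous_diskRetraction : Continuous diskRetraction := by
  have h : Continuous fun z : ℂ => (max 1 ‖z‖)⁻¹ :=
    Continuous.inv₀ (by fun_prop) fun z => (by positivity : (0 : ℝ) < max 1 ‖z‖).ne'
  exact Continuous.subtype_mk (h.smul continuous_id) _

theorem diskRetraction_of_mem {z : ℂ} (hz : z ∈ Metric.closedBall (0 : ℂ) 1) :
    (diskRetraction z : ℂ) = z := by
  have : ‖z‖ ≤ 1 := mem_closedBall_zero_iff.mp hz
  simp [diskRetraction, max_eq_left this]

/-- Integration against an integrable density on the disk. -/
noncomputable def diskFunctional {U : ℂ → ℝ} (hU : IntegrableOn U disk) :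
    C(Metric.closedBall (0 : ℂ) 1, ℂ) →L[ℂ] ℂ :=
  have hi : ∀ f : C(Metric.closedBall (0 : ℂ) 1, ℂ),
      IntegrableOn (fun z => f (diskRetraction z) • (U z : ℂ)) disk := fun f =>
    integrableOn_disk_smul hU.ofReal (f.continuous.comp continuous_diskRetraction)
  LinearMap.mkContinuous
    { toFun := fun f => ∫ z in disk, f (diskRetraction z) • (U z : ℂ)
      map_add' := fun f g => by
        rw [← integral_add (hi f) (hi g)]
        simp only [ContinuousMap.add_apply, add_smul]
      map_smul' := fun c f => by
        rw [RingHom.id_apply, ← integral_smul]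
        simp only [ContinuousMap.smul_apply, smul_eq_mul, mul_assoc] }
    (∫ z in disk, ‖U z‖) fun f => by
      rw [← integral_mul_const]
      refine norm_integral_le_of_norm_le (hU.norm.mul_const _)
        (Filter.Eventually.of_forall fun z => ?_)
      rw [norm_smul, mul_comm, Complex.norm_real]
      exact mul_le_mul_of_nonneg_left (f.norm_coe_le_norm _) (norm_nonneg _)

theorem diskFunctional_apply {U : ℂ → ℝ} (hU : IntegrableOn U disk)
    (f : C(Metric.closedBall (0 : ℂ) 1, ℂ)) :
    diskFunctional hU f = ∫ z in disk, f (diskRetraction z) • (U z : ℂ) := rfl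

theorem diskFunctional_eq_zero {U : ℂ → ℝ} (hU : IntegrableOn U disk)
    (h : ∀ a b : ℕ, ∫ z in disk, (z ^ a * (starRingEnd ℂ) z ^ b) • (U z : ℂ) = 0) :
    diskFunctional hU = 0 := by
  set X : C(Metric.closedBall (0 : ℂ) 1, ℂ) := .restrict _ (.id ℂ)
  have key : ∀ f g : C(Metric.closedBall (0 : ℂ) 1, ℂ),
      (∀ a b : ℕ, diskFunctional hU (X ^ a * star X ^ b * g) = 0) →
      ∀ a b : ℕ, diskFunctional hU (X ^ a * star X ^ b * (f * g)) = 0 := by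
    intro f
    induction f using ContinuousMap.induction_on_of_compact with
    | const r =>
      intro g hg a b
      have : X ^ a * star X ^ b * (ContinuousMap.const _ r * g) =
          r • (X ^ a * star X ^ b * g) := by
        ext z
        simp only [ContinuousMap.mul_apply, ContinuousMap.const_apply, ContinuousMap.smul_apply,
          smul_eq_mul]
        ring
      rw [this, map_smul, hg, smul_zero]
    | id =>
      intro g hg a b
      refine Eq.trans (congrArg _ ?_) (hg (a + 1) b)
      change X ^ a * star X ^ b * (X * g) = _
      ring
    | star_id =>
      intro g hg a b
      refine Eq.trans (congrArg _ ?_) (hg a (b + 1))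
      change X ^ a * star X ^ b * (star X * g) = _
      ring
    | add f f' hf hf' =>
      intro g hg a b
      rw [add_mul, mul_add, map_add, hf g hg, hf' g hg, add_zero]
    | mul f f' hf hf' =>
      intro g hg a b
      rw [mul_assoc f f' g]
      exact hf _ (hf' g hg) a b
    | frequently f hf =>
      intro g hg a b
      have hcl : IsClosed {f : C(Metric.closedBall (0 : ℂ) 1, ℂ) |
          diskFunctional hU (X ^ a * star X ^ b * (f * g)) = 0} :=
        isClosed_eq ((diskFunctional hU).continuous.comp (by fun_prop)) continuous_const
      exact isClosed_iff_frequently.mp hcl f (hf.mono fun f' hf' => hf' g hg a b)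
  ext f
  have h1 := key f 1 (fun a b => by
    rw [diskFunctional_apply]
    refine (setIntegral_congr_fun Metric.isOpen_ball.measurableSet fun z hz => ?_).trans (h a b)
    simp [X, diskRetraction_of_mem (Metric.ball_subset_closedBall hz)]) 0 0
  simpa using h1

theorem ae_eq_zero_of_moments {U : ℂ → ℝ} (hU : IntegrableOn U disk)
    (h : ∀ a b : ℕ, ∫ z in disk, (z ^ a * (starRingEnd ℂ) z ^ b) • (U z : ℂ) = 0) :
    U =ᵐ[volume.restrict disk] 0 := by
  have := Metric.isOpen_ball.ae_eq_zero_of_integral_contDiff_smul_eq_zero (μ := volume)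
    (U := disk) (f := U) hU.locallyIntegrableOn (by
      intro φ hφ hc hs
      have h1 : diskFunctional hU ⟨fun z => (φ z : ℂ), by
          have := hφ.continuous; fun_prop⟩ = 0 := by
        rw [diskFunctional_eq_zero hU h]; rfl
      rw [diskFunctional_apply] at h1
      have h2 : ∫ z in disk, φ z • U z = 0 := by
        rw [← Complex.ofReal_inj, ← integral_complex_ofReal, Complex.ofReal_zero, ← h1]
        refine setIntegral_congr_fun Metric.isOpen_ball.measurableSet fun z hz => ?_
        simp [diskRetraction_of_mem (Metric.ball_subset_closedBall hz)]
      rw [← h2]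
      refine (setIntegral_eq_integral_of_forall_compl_eq_zero fun z hz => ?_).symm
      rw [image_eq_zero_of_notMem_tsupport (fun hz' => hz (hs hz')), zero_smul])
  rw [Filter.EventuallyEq, ae_restrict_iff' Metric.isOpen_ball.measurableSet]
  exact this

/-! ### Moments of harmonic functions -/

theorem setIntegral_disk_eq_polar {f : ℂ → ℂ} (hf : ContinuousOn f (Metric.closedBall 0 1)) :
    ∫ z in disk, f z =
      ∫ r in (0 : ℝ)..1, r • ∫ θ in (0 : ℝ)..(2 * Real.pi), f (circleMap 0 r θ) := by
  have hsymm : ∀ p : ℝ × ℝ, Complex.polarCoord.symm p = circleMap 0 p.1 p.2 := fun p => by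
    rw [Complex.polarCoord_symm_apply, circleMap_zero, Complex.exp_mul_I]
    push_cast
    rfl
  have hcont : ContinuousOn (fun p : ℝ × ℝ => p.1 • f (circleMap 0 p.1 p.2))
      (Set.Icc 0 1 ×ˢ Set.Icc (-Real.pi) Real.pi) := by
    refine continuousOn_fst.smul (hf.comp (Continuous.continuousOn ?_) ?_)
    · simp only [circleMap_zero]; fun_prop
    · rintro ⟨r, θ⟩ ⟨hr, -⟩
      simpa [abs_of_nonneg hr.1] using hr.2
  have hint : IntegrableOn (fun p : ℝ × ℝ => p.1 • f (circleMap 0 p.1 p.2))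
      (Set.Ioo 0 1 ×ˢ Set.Ioo (-Real.pi) Real.pi) (volume.prod volume) :=
    (hcont.integrableOn_compact (isCompact_Icc.prod isCompact_Icc)).mono_set
      (Set.prod_mono Set.Ioo_subset_Icc_self Set.Ioo_subset_Icc_self)
  rw [← integral_indicator Metric.isOpen_ball.measurableSet,
    ← Complex.integral_comp_polarCoord_symm]
  have e : ∀ p : ℝ × ℝ, p ∈ polarCoord.target →
      p.1 • disk.indicator f (Complex.polarCoord.symm p) =
      (Set.Ioo (0 : ℝ) 1 ×ˢ Set.Ioo (-Real.pi) Real.pi).indicator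
        (fun p : ℝ × ℝ => p.1 • f (circleMap 0 p.1 p.2)) p := by
    rintro ⟨r, θ⟩ hp
    rw [polarCoord_target] at hp
    have hr : 0 < r := hp.1
    rw [hsymm]
    by_cases h1 : r < 1
    · rw [Set.indicator_of_mem, Set.indicator_of_mem]
      · exact ⟨⟨hr, h1⟩, hp.2⟩
      · simpa [abs_of_pos hr] using h1
    · rw [Set.indicator_of_notMem, Set.indicator_of_notMem, smul_zero]
      · exact fun h => h1 h.1.2
      · simpa [abs_of_pos hr] using h1
  rw [setIntegral_congr_fun polarCoord.open_target.measurableSet e,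
    setIntegral_indicator (measurableSet_Ioo.prod measurableSet_Ioo),
    polarCoord_target, Set.inter_eq_self_of_subset_right
      (Set.prod_mono (fun x hx => hx.1) subset_rfl), Measure.volume_eq_prod,
    setIntegral_prod _ hint, intervalIntegral.integral_of_le zero_le_one,
    integral_Ioc_eq_integral_Ioo]
  refine integral_congr_ae (Filter.Eventually.of_forall fun r => ?_)
  simp only [integral_smul]
  rw [← integral_Ioc_eq_integral_Ioo, ← intervalIntegral.integral_of_le (by
    linarith [Real.pi_pos])]
  have hper : Function.Periodic (fun θ => f (circleMap 0 r θ)) (2 * Real.pi) := fun θ => by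
    simp only [periodic_circleMap 0 r θ]
  have := hper.intervalIntegral_add_eq (-Real.pi) 0
  rw [zero_add, show -Real.pi + 2 * Real.pi = Real.pi by ring] at this
  rw [this]

theorem circleMap_zero_eq_mul (r θ : ℝ) : circleMap 0 r θ = r * circleMap 0 1 θ := by
  simp [circleMap_zero]

theorem integral_holomorphic_mul_pow {F : ℂ → ℂ} (hF : DifferentiableOn ℂ F disk) (k : ℕ) :
    ∃ C : ℂ, ∀ r ∈ Set.Ioo (0 : ℝ) 1,
      ∫ θ in (0 : ℝ)..(2 * Real.pi), F (circleMap 0 r θ) * circleMap 0 1 θ ^ k = C * r ^ k := by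
  have h1 : ∀ r ∈ Set.Ioo (0 : ℝ) 1, (r : ℂ) ^ k *
      ∫ θ in (0 : ℝ)..(2 * Real.pi), F (circleMap 0 r θ) * circleMap 0 1 θ ^ k =
      2 * Real.pi * (F 0 * 0 ^ k) := by
    intro r hr
    have hsub : Metric.closedBall (0 : ℂ) r ⊆ disk := Metric.closedBall_subset_ball hr.2
    have hd : DiffContOnCl ℂ (fun z => F z * z ^ k) (Metric.ball 0 |r|) := by
      refine DifferentiableOn.diffContOnCl (DifferentiableOn.mul ?_ (by fun_prop))
      rw [abs_of_pos hr.1, closure_ball _ hr.1.ne']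
      exact hF.mono hsub
    have := hd.circleAverage
    rw [Real.circleAverage, inv_smul_eq_iff₀ (by positivity)] at this
    rw [← intervalIntegral.integral_const_mul]
    convert this using 1
    · congr 1
      funext θ
      rw [circleMap_zero_eq_mul r θ]
      ring
    · simp
  rcases Nat.eq_zero_or_pos k with rfl | hk
  · exact ⟨2 * Real.pi * F 0, fun r hr => by simpa using h1 r hr⟩
  · refine ⟨0, fun r hr => ?_⟩
    have := h1 r hr
    rw [zero_pow hk.ne', mul_zero, mul_zero] at this
    have hr0 : (r : ℂ) ^ k ≠ 0 := pow_ne_zero _ (Complex.ofReal_ne_zero.mpr hr.1.ne')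
    rw [zero_mul]
    exact (mul_eq_zero.mp this).resolve_left hr0

theorem integral_holomorphic_mul_inv_pow {F : ℂ → ℂ} (hF : DifferentiableOn ℂ F disk) (k : ℕ) :
    ∃ C : ℂ, ∀ r ∈ Set.Ioo (0 : ℝ) 1,
      ∫ θ in (0 : ℝ)..(2 * Real.pi), F (circleMap 0 r θ) * (circleMap 0 1 θ ^ k)⁻¹ =
        C * r ^ k := by
  set f : ℂ → ℂ := fun z => F z * (z ^ k)⁻¹ with hf
  have hcirc : ∀ r ∈ Set.Ioo (0 : ℝ) 1, (∮ z in C(0, r), (z - 0)⁻¹ • f z) =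
      Complex.I * ((r : ℂ) ^ k)⁻¹ *
        ∫ θ in (0 : ℝ)..(2 * Real.pi), F (circleMap 0 r θ) * (circleMap 0 1 θ ^ k)⁻¹ := by
    intro r hr
    rw [circleIntegral, ← intervalIntegral.integral_const_mul]
    congr 1
    funext θ
    have h0 : circleMap 0 r θ ≠ 0 := circleMap_ne_center hr.1.ne'
    simp only [hf, deriv_circleMap, sub_zero, smul_eq_mul]
    rw [mul_comm _ Complex.I, mul_assoc, mul_inv_cancel_left₀ h0, circleMap_zero_eq_mul r θ,
      mul_pow, mul_inv]
    ring
  have hconst : ∀ r R : ℝ, 0 < r → r ≤ R → R < 1 →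
      (∮ z in C(0, R), (z - 0)⁻¹ • f z) = ∮ z in C(0, r), (z - 0)⁻¹ • f z := by
    intro r R hr hrR hR
    have hd : DifferentiableOn ℂ f (Metric.closedBall 0 R \ Metric.ball 0 r) := by
      refine DifferentiableOn.mul (hF.mono fun z hz => Metric.closedBall_subset_ball hR hz.1)
        (DifferentiableOn.inv (by fun_prop) fun z hz => pow_ne_zero _ ?_)
      rintro rfl
      exact hz.2 (Metric.mem_ball_self hr)
    refine Complex.circleIntegral_sub_center_inv_smul_eq_of_differentiable_on_annulus_off_countable
      hr hrR Set.countable_empty hd.continuousOn fun z hz => ?_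
    refine (hd.mono (s := Metric.ball 0 R \ Metric.closedBall 0 r) ?_).differentiableAt ?_
    · exact Set.sdiff_subset_sdiff Metric.ball_subset_closedBall Metric.ball_subset_closedBall
    · exact (Metric.isOpen_ball.sdiff Metric.isClosed_closedBall).mem_nhds hz.1
  refine ⟨-Complex.I * ∮ z in C(0, 1 / 2), (z - 0)⁻¹ • f z, fun r hr => ?_⟩
  have e : (∮ z in C(0, 1 / 2), (z - 0)⁻¹ • f z) = ∮ z in C(0, r), (z - 0)⁻¹ • f z := by
    rcases le_total r (1 / 2) with h | h
    · exact hconst r (1 / 2) hr.1 h (by norm_num)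
    · exact (hconst (1 / 2) r (by norm_num) h hr.2).symm
  have hr0 : (r : ℂ) ^ k ≠ 0 := pow_ne_zero _ (Complex.ofReal_ne_zero.mpr hr.1.ne')
  rw [e, hcirc r hr]
  field_simp
  rw [Complex.I_sq]
  ring

theorem integral_harmonic_mul_pow {h : ℂ → ℝ} (hh : InnerProductSpace.HarmonicOnNhd h disk)
    (k : ℕ) : ∃ C : ℂ, ∀ r ∈ Set.Ioo (0 : ℝ) 1,
      ∫ θ in (0 : ℝ)..(2 * Real.pi), circleMap 0 1 θ ^ k * h (circleMap 0 r θ) = C * r ^ k := by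
  obtain ⟨F, hF, hFh⟩ := hh.exists_analyticOnNhd_ball_re_eq
  obtain ⟨C₁, h₁⟩ := integral_holomorphic_mul_pow hF.differentiableOn k
  obtain ⟨C₂, h₂⟩ := integral_holomorphic_mul_inv_pow hF.differentiableOn k
  refine ⟨(C₁ + (starRingEnd ℂ) C₂) / 2, fun r hr => ?_⟩
  have hmem : ∀ θ, circleMap 0 r θ ∈ disk := fun θ => by
    simpa [abs_of_pos hr.1] using hr.2
  have hcF : Continuous fun θ => F (circleMap 0 r θ) :=
    hF.continuousOn.comp_continuous (continuous_circleMap 0 r) hmem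
  have hc1 : Continuous fun θ => circleMap 0 1 θ := continuous_circleMap 0 1
  have hne : ∀ θ, circleMap 0 1 θ ^ k ≠ 0 := fun θ =>
    pow_ne_zero _ (circleMap_ne_center one_ne_zero)
  have h₃ := congrArg (starRingEnd ℂ) (h₂ r hr)
  rw [← intervalIntegral.intervalIntegral_conj, map_mul, map_pow, Complex.conj_ofReal] at h₃
  have e : ∀ θ, circleMap 0 1 θ ^ k * (h (circleMap 0 r θ) : ℂ) =
      (1 / 2) * (F (circleMap 0 r θ) * circleMap 0 1 θ ^ k +
        (starRingEnd ℂ) (F (circleMap 0 r θ) * (circleMap 0 1 θ ^ k)⁻¹)) := by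
    intro θ
    have h4 : (starRingEnd ℂ) (circleMap 0 1 θ ^ k)⁻¹ = circleMap 0 1 θ ^ k := by
      rw [← Complex.inv_eq_conj (by simp), inv_inv]
    rw [map_mul, h4, ← hFh (hmem θ)]
    have := Complex.add_conj (F (circleMap 0 r θ))
    push_cast at this
    linear_combination (-1 / 2 * circleMap 0 1 θ ^ k) * this
  simp only [e]
  rw [intervalIntegral.integral_const_mul, intervalIntegral.integral_add, h₁ r hr, h₃]
  · ring
  · exact (hcF.mul (hc1.pow k)).intervalIntegrable _ _
  · exact (Complex.continuous_conj.comp (hcF.mul ((hc1.pow k).inv₀ hne))).intervalIntegrable _ _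

theorem integral_harmonic_mul_pow_boundary {h : ℂ → ℝ}
    (hh : InnerProductSpace.HarmonicOnNhd h disk)
    (hc : ContinuousOn h (Metric.closedBall 0 1)) (k : ℕ) {r : ℝ} (hr : r ∈ Set.Icc (0 : ℝ) 1) :
    ∫ θ in (0 : ℝ)..(2 * Real.pi), circleMap 0 1 θ ^ k * h (circleMap 0 r θ) =
      (∫ θ in (0 : ℝ)..(2 * Real.pi), circleMap 0 1 θ ^ k * h (circleMap 0 1 θ)) * r ^ k := by
  obtain ⟨C, hC⟩ := integral_harmonic_mul_pow hh k
  have hcont : ContinuousOn (fun r : ℝ =>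
      ∫ θ in (0 : ℝ)..(2 * Real.pi), circleMap 0 1 θ ^ k * (h (circleMap 0 r θ) : ℂ))
      (Set.Icc 0 1) := by
    have hcr : Continuous fun z => (h (diskRetraction z) : ℂ) :=
      Complex.continuous_ofReal.comp (hc.comp_continuous
        (continuous_subtype_val.comp continuous_diskRetraction) fun z => (diskRetraction z).2)
    have hcirc : Continuous fun p : ℝ × ℝ => circleMap 0 p.1 p.2 := by
      simp only [circleMap_zero]; fun_prop
    have h1 : Continuous fun r : ℝ => ∫ θ in (0 : ℝ)..(2 * Real.pi),
        circleMap 0 1 θ ^ k * (h (diskRetraction (circleMap 0 r θ)) : ℂ) := by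
      refine intervalIntegral.continuous_parametric_intervalIntegral_of_continuous' ?_ _ _
      exact ((((continuous_circleMap 0 1).comp continuous_snd).pow k).mul (hcr.comp hcirc))
    refine h1.continuousOn.congr fun r hr => ?_
    simp only
    congr 1
    funext θ
    rw [diskRetraction_of_mem]
    simpa [abs_of_nonneg hr.1] using hr.2
  have heq : Set.EqOn (fun r : ℝ =>
      ∫ θ in (0 : ℝ)..(2 * Real.pi), circleMap 0 1 θ ^ k * (h (circleMap 0 r θ) : ℂ))
      (fun r : ℝ => C * (r : ℂ) ^ k) (Set.Icc 0 1) := by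
    have hcl : closure (Set.Ioo (0 : ℝ) 1) = Set.Icc 0 1 := closure_Ioo zero_ne_one
    refine Set.EqOn.of_subset_closure (s := Set.Ioo (0 : ℝ) 1) (fun r hr => hC r hr) hcont
      (by fun_prop) Set.Ioo_subset_Icc_self hcl.ge
  have h1 := heq (Set.right_mem_Icc.mpr zero_le_one)
  have h2 := heq hr
  simp only [Complex.ofReal_one, one_pow, mul_one] at h1 h2
  rw [h1, h2]

/-- The moments of a harmonic function on the disk in terms of its boundary values. -/
theorem setIntegral_moment_harmonic {h : ℂ → ℝ} (hh : InnerProductSpace.HarmonicOnNhd h disk)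
    (hc : ContinuousOn h (Metric.closedBall 0 1)) (d k : ℕ) :
    2 * (d + k + 1 : ℂ) * ∫ z in disk, (z ^ (d + k) * (starRingEnd ℂ) z ^ d) • (h z : ℂ) =
      ∫ θ in (0 : ℝ)..(2 * Real.pi), circleMap 0 1 θ ^ k * h (circleMap 0 1 θ) := by
  have hcc : ContinuousOn (fun z => (z ^ (d + k) * (starRingEnd ℂ) z ^ d) • (h z : ℂ))
      (Metric.closedBall 0 1) := by
    have : ContinuousOn (fun z => (h z : ℂ)) (Metric.closedBall 0 1) :=
      Complex.continuous_ofReal.comp_continuousOn hc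
    exact (((continuous_pow _).mul (Complex.continuous_conj.pow d)).continuousOn).smul this
  set K := ∫ θ in (0 : ℝ)..(2 * Real.pi), circleMap 0 1 θ ^ k * (h (circleMap 0 1 θ) : ℂ)
    with hK
  rw [setIntegral_disk_eq_polar hcc]
  have e : ∀ r ∈ Set.uIcc (0 : ℝ) 1, r • ∫ θ in (0 : ℝ)..(2 * Real.pi),
      (circleMap 0 r θ ^ (d + k) * (starRingEnd ℂ) (circleMap 0 r θ) ^ d) •
        (h (circleMap 0 r θ) : ℂ) = K * ((r ^ (2 * (d + k) + 1) : ℝ) : ℂ) := by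
    intro r hr
    rw [Set.uIcc_of_le zero_le_one] at hr
    have e1 : ∀ θ, (circleMap 0 r θ ^ (d + k) * (starRingEnd ℂ) (circleMap 0 r θ) ^ d) •
        (h (circleMap 0 r θ) : ℂ) =
        (r : ℂ) ^ (2 * d + k) * (circleMap 0 1 θ ^ k * h (circleMap 0 r θ)) := by
      intro θ
      have e2 : circleMap 0 r θ * (starRingEnd ℂ) (circleMap 0 r θ) = (r : ℂ) ^ 2 := by
        rw [Complex.mul_conj, Complex.normSq_eq_norm_sq]
        simp
      rw [pow_add, mul_right_comm, ← mul_pow, e2, circleMap_zero_eq_mul r θ, smul_eq_mul]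
      ring
    simp only [e1]
    rw [intervalIntegral.integral_const_mul, integral_harmonic_mul_pow_boundary hh hc k hr, ← hK,
      Complex.real_smul]
    push_cast
    ring
  rw [intervalIntegral.integral_congr e, intervalIntegral.integral_const_mul,
    intervalIntegral.integral_ofReal, integral_pow]
  have : (2 * (d + k : ℂ) + 1 + 1) ≠ 0 := by
    exact_mod_cast (by positivity : 2 * (d + k) + 1 + 1 ≠ 0)
  push_cast
  rw [one_pow, zero_pow (by positivity), sub_zero]
  field_simp
  ring

/-! ### Moments of the mean of a minimizer -/

theorem hasFDerivAt_pow_mul_conj_pow (p q : ℕ) (z : ℂ) :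
    HasFDerivAt (fun z : ℂ => z ^ p * (starRingEnd ℂ) z ^ q)
      ((p * z ^ (p - 1) * (starRingEnd ℂ) z ^ q) • ContinuousLinearMap.id ℝ ℂ +
        (q * z ^ p * (starRingEnd ℂ) z ^ (q - 1)) • (Complex.conjCLE : ℂ →L[ℝ] ℂ)) z := by
  have h1 : HasFDerivAt (fun z : ℂ => z ^ p)
      ((p * z ^ (p - 1)) • ContinuousLinearMap.id ℝ ℂ) z := by
    simpa using (hasFDerivAt_id (𝕜 := ℝ) z).pow p
  have h2 : HasFDerivAt (fun z : ℂ => (starRingEnd ℂ) z ^ q)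
      ((q * (starRingEnd ℂ) z ^ (q - 1)) • (Complex.conjCLE : ℂ →L[ℝ] ℂ)) z := by
    simpa using (Complex.conjCLE.hasFDerivAt (x := z)).pow q
  refine (h1.mul h2).congr_fderiv ?_
  ext v
  simp
  ring

theorem fderiv_pow_mul_conj_pow (p q : ℕ) (z v : ℂ) :
    fderiv ℝ (fun z : ℂ => z ^ p * (starRingEnd ℂ) z ^ q) z v =
      p * (z ^ (p - 1) * (starRingEnd ℂ) z ^ q) * v +
        q * (z ^ p * (starRingEnd ℂ) z ^ (q - 1)) * (starRingEnd ℂ) v := by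
  rw [(hasFDerivAt_pow_mul_conj_pow p q z).fderiv]
  simp [mul_assoc]

theorem contDiff_pow_mul_conj_pow (p q : ℕ) {k : WithTop ℕ∞} :
    ContDiff ℝ k fun z : ℂ => z ^ p * (starRingEnd ℂ) z ^ q :=
  (contDiff_id.pow p).mul (Complex.conjCLE.contDiff.pow q)

theorem differentiableAt_pow_mul_conj_pow (p q : ℕ) (z : ℂ) :
    DifferentiableAt ℝ (fun z : ℂ => z ^ p * (starRingEnd ℂ) z ^ q) z :=
  (hasFDerivAt_pow_mul_conj_pow p q z).differentiableAt

theorem fderiv_fderiv_pow_mul_conj_pow (p q : ℕ) (z v : ℂ) :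
    fderiv ℝ (fun z => fderiv ℝ (fun z : ℂ => z ^ p * (starRingEnd ℂ) z ^ q) z v) z v =
      p * (p - 1 : ℕ) * (z ^ (p - 1 - 1) * (starRingEnd ℂ) z ^ q) * v ^ 2 +
      2 * p * q * (z ^ (p - 1) * (starRingEnd ℂ) z ^ (q - 1)) * (v * (starRingEnd ℂ) v) +
      q * (q - 1 : ℕ) * (z ^ p * (starRingEnd ℂ) z ^ (q - 1 - 1)) * (starRingEnd ℂ) v ^ 2 := by
  have d := differentiableAt_pow_mul_conj_pow
  simp only [fderiv_pow_mul_conj_pow]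
  rw [fderiv_fun_add (((d _ _ _).const_mul _).mul_const _) (((d _ _ _).const_mul _).mul_const _),
    fderiv_mul_const ((d _ _ _).const_mul _), fderiv_mul_const ((d _ _ _).const_mul _),
    fderiv_const_mul (d _ _ _), fderiv_const_mul (d _ _ _)]
  simp only [_root_.add_apply, _root_.smul_apply, smul_eq_mul,
    fderiv_pow_mul_conj_pow]
  ring

/-- Green's identity for a weakly harmonic function `U` with boundary values `b`, tested with
complex-valued functions vanishing on the circle. -/
theorem green_complex {U : ℂ → ℝ} {b : Circle → ℝ} (hU : IntegrableOn U disk)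
    (hb : Continuous b)
    (h : ∀ w : ℂ → ℝ, ContDiff ℝ 2 w → (∀ z : ℂ, ‖z‖ = 1 → w z = 0) →
      ∫ z in disk, (fderiv ℝ (fun z => fderiv ℝ w z 1) z 1 +
        fderiv ℝ (fun z => fderiv ℝ w z Complex.I) z Complex.I) • U z =
      ∫ θ in (0 : ℝ)..(2 * Real.pi), (fderiv ℝ w (Circle.exp θ) 1 * Real.cos θ +
        fderiv ℝ w (Circle.exp θ) Complex.I * Real.sin θ) • b (Circle.exp θ))
    {W : ℂ → ℂ} (hW : ContDiff ℝ 2 W) (h0 : ∀ z : ℂ, ‖z‖ = 1 → W z = 0) :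
    ∫ z in disk, (fderiv ℝ (fun z => fderiv ℝ W z 1) z 1 +
        fderiv ℝ (fun z => fderiv ℝ W z Complex.I) z Complex.I) • (U z : ℂ) =
      ∫ θ in (0 : ℝ)..(2 * Real.pi), (fderiv ℝ W (Circle.exp θ) 1 * Real.cos θ +
        fderiv ℝ W (Circle.exp θ) Complex.I * Real.sin θ) • (b (Circle.exp θ) : ℂ) := by
  have hW1 : ∀ v, ContDiff ℝ 1 fun z => fderiv ℝ W z v := fun v =>
    (hW.fderiv_right (m := 1) (by norm_num)).clm_apply contDiff_const
  have hexp : Continuous fun θ : ℝ => (Circle.exp θ : ℂ) :=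
    continuous_subtype_val.comp Circle.exp.continuous
  have i1 : IntegrableOn (fun z => (fderiv ℝ (fun z => fderiv ℝ W z 1) z 1 +
      fderiv ℝ (fun z => fderiv ℝ W z Complex.I) z Complex.I) • (U z : ℂ)) disk :=
    integrableOn_disk_smul hU.ofReal ((continuous_fderiv_apply one_ne_zero (hW1 1) 1).add
      (continuous_fderiv_apply one_ne_zero (hW1 Complex.I) Complex.I))
  have i2 : IntervalIntegrable (fun θ : ℝ => (fderiv ℝ W (Circle.exp θ) 1 * Real.cos θ +
      fderiv ℝ W (Circle.exp θ) Complex.I * Real.sin θ) • (b (Circle.exp θ) : ℂ)) volume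
      0 (2 * Real.pi) := by
    refine Continuous.intervalIntegrable ?_ _ _
    have c1 := (continuous_fderiv_apply two_ne_zero hW 1).comp hexp
    have c2 := (continuous_fderiv_apply two_ne_zero hW Complex.I).comp hexp
    have c3 := hb.comp Circle.exp.continuous
    simp only [Function.comp_def] at c1 c2 c3
    fun_prop
  have key : ∀ l : ℂ →L[ℝ] ℝ, l (∫ z in disk, (fderiv ℝ (fun z => fderiv ℝ W z 1) z 1 +
        fderiv ℝ (fun z => fderiv ℝ W z Complex.I) z Complex.I) • (U z : ℂ)) =
      l (∫ θ in (0 : ℝ)..(2 * Real.pi), (fderiv ℝ W (Circle.exp θ) 1 * Real.cos θ +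
        fderiv ℝ W (Circle.exp θ) Complex.I * Real.sin θ) • (b (Circle.exp θ) : ℂ)) := by
    intro l
    have hl : ∀ (a : ℂ) (x : ℝ), l (a * x) = l a * x := fun a x => by
      rw [mul_comm, ← Complex.real_smul, map_smul, smul_eq_mul, mul_comm]
    have d1 : ∀ z v, fderiv ℝ (fun z => l (W z)) z v = l (fderiv ℝ W z v) := fun z v => by
      have := l.hasFDerivAt.comp z (hW.differentiable two_ne_zero z).hasFDerivAt
      rw [show (fun z => l (W z)) = l ∘ W from rfl, this.fderiv]
      rfl
    have d2 : ∀ z v, fderiv ℝ (fun z => l (fderiv ℝ W z v)) z v =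
        l (fderiv ℝ (fun z => fderiv ℝ W z v) z v) := fun z v => by
      have := l.hasFDerivAt.comp z ((hW1 v).differentiable one_ne_zero z).hasFDerivAt
      rw [show (fun z => l (fderiv ℝ W z v)) = l ∘ (fun z => fderiv ℝ W z v) from rfl,
        this.fderiv]
      rfl
    have h1 := h (fun z => l (W z)) (l.contDiff.comp hW) fun z hz => by rw [h0 z hz, map_zero]
    simp only [d1, d2] at h1
    rw [← l.integral_comp_comm i1, ← l.intervalIntegral_comp_comm i2]
    simpa only [smul_eq_mul, hl, map_add] using h1
  exact Complex.ext (key Complex.reCLM) (key Complex.imCLM)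

theorem moment_of_green {U : ℂ → ℝ} {b : Circle → ℝ} (hU : IntegrableOn U disk)
    (hb : Continuous b)
    (h : ∀ w : ℂ → ℝ, ContDiff ℝ 2 w → (∀ z : ℂ, ‖z‖ = 1 → w z = 0) →
      ∫ z in disk, (fderiv ℝ (fun z => fderiv ℝ w z 1) z 1 +
        fderiv ℝ (fun z => fderiv ℝ w z Complex.I) z Complex.I) • U z =
      ∫ θ in (0 : ℝ)..(2 * Real.pi), (fderiv ℝ w (Circle.exp θ) 1 * Real.cos θ +
        fderiv ℝ w (Circle.exp θ) Complex.I * Real.sin θ) • b (Circle.exp θ)) (d k : ℕ) :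
    2 * (d + k + 1 : ℂ) * ∫ z in disk, (z ^ (d + k) * (starRingEnd ℂ) z ^ d) • (U z : ℂ) =
      ∫ θ in (0 : ℝ)..(2 * Real.pi), circleMap 0 1 θ ^ k * (b (Circle.exp θ) : ℂ) := by
  set M : ℕ → ℕ → ℂ → ℂ := fun p q z => z ^ p * (starRingEnd ℂ) z ^ q with hM
  set W : ℂ → ℂ := fun z => M (d + k + 1) (d + 1) z - M k 0 z with hWdef
  have hW : ContDiff ℝ 2 W := (contDiff_pow_mul_conj_pow _ _).sub (contDiff_pow_mul_conj_pow _ _)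
  have hone : ∀ z : ℂ, ‖z‖ = 1 → z * (starRingEnd ℂ) z = 1 := fun z hz => by
    rw [Complex.mul_conj, Complex.normSq_eq_norm_sq, hz]; simp
  have h0 : ∀ z : ℂ, ‖z‖ = 1 → W z = 0 := fun z hz => by
    have e : W z = z ^ k * ((z * (starRingEnd ℂ) z) ^ (d + 1) - 1) := by
      simp only [hWdef, hM]; ring
    rw [e, hone z hz]; ring
  have dW : ∀ z v, fderiv ℝ W z v = fderiv ℝ (M (d + k + 1) (d + 1)) z v -
      fderiv ℝ (M k 0) z v := fun z v => by
    rw [hWdef, fderiv_fun_sub (differentiableAt_pow_mul_conj_pow _ _ _)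
      (differentiableAt_pow_mul_conj_pow _ _ _)]
    rfl
  have dM : ∀ p q v z, DifferentiableAt ℝ (fun z => fderiv ℝ (M p q) z v) z := fun p q v z =>
    (((contDiff_pow_mul_conj_pow p q (k := 2)).fderiv_right (m := 1)
      (by norm_num)).clm_apply contDiff_const).differentiable one_ne_zero z
  have ddW : ∀ z v, fderiv ℝ (fun z => fderiv ℝ W z v) z v =
      fderiv ℝ (fun z => fderiv ℝ (M (d + k + 1) (d + 1)) z v) z v -
      fderiv ℝ (fun z => fderiv ℝ (M k 0) z v) z v := fun z v => by
    simp only [dW]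
    rw [fderiv_fun_sub (dM _ _ _ _) (dM _ _ _ _)]
    rfl
  have lap : ∀ z, fderiv ℝ (fun z => fderiv ℝ W z 1) z 1 +
      fderiv ℝ (fun z => fderiv ℝ W z Complex.I) z Complex.I =
      4 * (d + k + 1) * (d + 1) * (z ^ (d + k) * (starRingEnd ℂ) z ^ d) := fun z => by
    rw [ddW, ddW, hM]
    simp only [fderiv_fderiv_pow_mul_conj_pow, map_one, Complex.conj_I]
    have hI := Complex.I_sq
    simp only [mul_neg, ← sq, neg_sq, hI]
    push_cast
    simp
    ring
  have nor : ∀ θ : ℝ, fderiv ℝ W (Circle.exp θ) 1 * Real.cos θ +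
      fderiv ℝ W (Circle.exp θ) Complex.I * Real.sin θ = 2 * (d + 1) * circleMap 0 1 θ ^ k := by
    intro θ
    have hz : (Circle.exp θ : ℂ) = circleMap 0 1 θ := by simp [circleMap_zero]
    have hcs : circleMap 0 1 θ = Real.cos θ + Complex.I * Real.sin θ := by
      rw [circleMap_zero, Complex.exp_mul_I]; simp [mul_comm]
    have hn : ‖circleMap 0 1 θ‖ = 1 := by simp
    rw [hz]
    generalize circleMap 0 1 θ = z at *
    have hlin : fderiv ℝ W z 1 * Real.cos θ + fderiv ℝ W z Complex.I * Real.sin θ =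
        fderiv ℝ W z z := by
      have e : z = (Real.cos θ) • (1 : ℂ) + (Real.sin θ) • Complex.I := by
        rw [hcs]; simp [mul_comm]
      conv_rhs => rw [e, map_add, map_smul, map_smul, ← e]
      simp [mul_comm]
    rw [hlin, dW, hM]
    simp only [fderiv_pow_mul_conj_pow, Nat.add_sub_cancel]
    have h1 := hone z hn
    have hk : (k : ℂ) * (z ^ (k - 1) * (starRingEnd ℂ) z ^ 0) * z = k * z ^ k := by
      cases k <;> simp [pow_succ]; ring
    have h2 : z ^ (d + k) * (starRingEnd ℂ) z ^ (d + 1) * z = z ^ k := by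
      rw [show z ^ (d + k) * (starRingEnd ℂ) z ^ (d + 1) * z =
        z ^ k * (z * (starRingEnd ℂ) z) ^ (d + 1) by ring, h1]; ring
    have h3 : z ^ (d + k + 1) * (starRingEnd ℂ) z ^ d * (starRingEnd ℂ) z = z ^ k := by
      rw [← h2]; ring
    rw [hk]
    push_cast
    linear_combination (d + k + 1 : ℂ) * h2 + (d + 1 : ℂ) * h3
  have := green_complex hU hb h hW h0
  simp only [lap, nor, smul_eq_mul, mul_assoc (2 * ((d : ℂ) + 1)),
    mul_assoc (4 * ((d : ℂ) + k + 1) * (d + 1)), intervalIntegral.integral_const_mul,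
    integral_const_mul] at this
  have hd : (2 * ((d : ℂ) + 1)) ≠ 0 := by exact_mod_cast (by positivity : 2 * (d + 1) ≠ 0)
  refine mul_left_cancel₀ hd ?_
  rw [← this]
  simp only [smul_eq_mul]
  ring

theorem ae_eq_harmonic_of_green {U h : ℂ → ℝ} {b : Circle → ℝ} (hU : IntegrableOn U disk)
    (hgreen : ∀ w : ℂ → ℝ, ContDiff ℝ 2 w → (∀ z : ℂ, ‖z‖ = 1 → w z = 0) →
      ∫ z in disk, (fderiv ℝ (fun z => fderiv ℝ w z 1) z 1 +
        fderiv ℝ (fun z => fderiv ℝ w z Complex.I) z Complex.I) • U z =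
      ∫ θ in (0 : ℝ)..(2 * Real.pi), (fderiv ℝ w (Circle.exp θ) 1 * Real.cos θ +
        fderiv ℝ w (Circle.exp θ) Complex.I * Real.sin θ) • b (Circle.exp θ))
    (hb : Continuous b) (hh : IsHarmonicExtension b h) : U =ᵐ[volume.restrict disk] h := by
  have hhi : IntegrableOn h disk :=
    (hh.continuousOn.integrableOn_compact (isCompact_closedBall (0 : ℂ) 1)).mono_set
      Metric.ball_subset_closedBall
  have hmono : ∀ (a c : ℕ) {V : ℂ → ℝ}, IntegrableOn V disk →
      IntegrableOn (fun z => (z ^ a * (starRingEnd ℂ) z ^ c) • (V z : ℂ)) disk := fun a c V hV =>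
    integrableOn_disk_smul hV.ofReal (contDiff_pow_mul_conj_pow (k := 1) a c).continuous
  have hm : ∀ d k : ℕ,
      ∫ z in disk, (z ^ (d + k) * (starRingEnd ℂ) z ^ d) • ((U z - h z : ℝ) : ℂ) = 0 := by
    intro d k
    have h1 := moment_of_green hU hb hgreen d k
    have h2 := setIntegral_moment_harmonic hh.harmonic hh.continuousOn d k
    have h3 : ∀ θ : ℝ, h (circleMap 0 1 θ) = b (Circle.exp θ) := fun θ => by
      rw [← hh.boundary]; simp [circleMap_zero]
    simp only [h3] at h2
    have hd : (2 * ((d : ℂ) + k + 1)) ≠ 0 := by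
      exact_mod_cast (by positivity : 2 * (d + k + 1) ≠ 0)
    simp only [Complex.ofReal_sub, smul_sub]
    rw [integral_sub (hmono _ _ hU) (hmono _ _ hhi), sub_eq_zero]
    exact mul_left_cancel₀ hd (h1.trans h2.symm)
  have hz := ae_eq_zero_of_moments (hU.sub hhi) (fun a c => by
    rcases le_total c a with hca | hca
    · obtain ⟨k, rfl⟩ := Nat.exists_eq_add_of_le hca
      exact hm c k
    · obtain ⟨k, rfl⟩ := Nat.exists_eq_add_of_le hca
      have := congrArg (starRingEnd ℂ) (hm a k)
      rw [← integral_conj, map_zero] at this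
      rw [← this]
      congr 1
      funext z
      simp [mul_comm])
  filter_upwards [hz] with z hz
  exact sub_eq_zero.mp hz

section Minimizer

variable {n : ℕ} {H : ℂ → A2 n} {G₁ G₂ : ℂ → EN n}

theorem IsDirMinimizing.green_mean {T : Circle → EN n} (hH : IsDirMinimizing H)
    (hG : IsTraceGradient (fun z => zeta (H z)) G₁ G₂ T) (e : E n) {w : ℂ → ℝ}
    (hw : ContDiff ℝ 2 w) (h0 : ∀ z : ℂ, ‖z‖ = 1 → w z = 0) :
    ∫ z in disk, (fderiv ℝ (fun z => fderiv ℝ w z 1) z 1 +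
        fderiv ℝ (fun z => fderiv ℝ w z Complex.I) z Complex.I) •
        (inner ℝ e (meanMap n (zeta (H z))) : ℝ) =
      ∫ θ in (0 : ℝ)..(2 * Real.pi), (fderiv ℝ w (Circle.exp θ) 1 * Real.cos θ +
        fderiv ℝ w (Circle.exp θ) Complex.I * Real.sin θ) •
        (inner ℝ e (meanMap n (T (Circle.exp θ))) : ℝ) := by
  have hw1 : ∀ v, ContDiff ℝ 1 fun z => fderiv ℝ w z v := fun v =>
    (hw.fderiv_right (m := 1) (by norm_num)).clm_apply contDiff_const
  have h1 := (hG.clm_comp (innerSL ℝ e ∘L meanMap n)).green _ _ (hw1 1) (hw1 Complex.I)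
  have h2 := hH.integral_inner_eq_zero hG (f := fun z => w z • e)
    (g₁ := fun z => fderiv ℝ w z 1 • e) (g₂ := fun z => fderiv ℝ w z Complex.I • e) (by
      simpa using (isTraceGradient_of_eq_zero (hw.of_le one_le_two) h0).clm_comp
        (ContinuousLinearMap.toSpanSingleton ℝ e))
  simp only [ContinuousLinearMap.comp_apply, innerSL_apply_apply] at h1
  simp only [inner_smul_right, real_inner_comm] at h2
  rw [h1]
  simp only [smul_eq_mul]
  rw [h2, neg_zero, zero_add]

/-- The mean of a minimizer with continuous boundary values is harmonic. -/
theorem IsDirMinimizing.mean_ae_eq {T : Circle → EN n} {b : Circle → E n} {h : ℂ → E n}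
    (hH : IsDirMinimizing H) (hG : IsTraceGradient (fun z => zeta (H z)) G₁ G₂ T)
    (hT : ∀ z, meanMap n (T z) = b z) (hb : Continuous b) (hh : IsHarmonicExtension b h) :
    (fun z => meanMap n (zeta (H z))) =ᵐ[volume.restrict disk] h := by
  have key : ∀ i : Fin n, (fun z => (inner ℝ (EuclideanSpace.single i (1 : ℝ))
      (meanMap n (zeta (H z))) : ℝ)) =ᵐ[volume.restrict disk]
      fun z => inner ℝ (EuclideanSpace.single i (1 : ℝ)) (h z) := by
    intro i
    refine ae_eq_harmonic_of_green
      (b := fun z => inner ℝ (EuclideanSpace.single i (1 : ℝ)) (b z)) ?_ ?_ ?_ ?_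
    · exact (hG.isWeakGradient.clm_comp
        (innerSL ℝ (EuclideanSpace.single i (1 : ℝ)) ∘L meanMap n)).memLp.integrableOn_disk
    · intro w hw h0
      have := hH.green_mean hG (EuclideanSpace.single i (1 : ℝ)) hw h0
      simpa only [hT] using this
    · exact continuous_const.inner hb
    · exact
        { harmonic := hh.harmonic.comp_CLM (innerSL ℝ (EuclideanSpace.single i (1 : ℝ)))
          continuousOn := continuousOn_const.inner hh.continuousOn
          boundary := fun z => by rw [hh.boundary] }
  filter_upwards [ae_all_iff.mpr key] with z hz
  ext i
  simpa [EuclideanSpace.inner_single_left] using hz i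

end Minimizer

theorem dirA2_addFun_of_mean_eq_zero {n : ℕ} {H : ℂ → A2 n} {G₁ G₂ : ℂ → EN n} {T : Circle → EN n}
    (hH : IsDirMinimizing H) (hG : IsTraceGradient (fun z => zeta (H z)) G₁ G₂ T)
    (hT : ∀ z, meanMap n (T z) = 0) (h : ℂ → E n) :
    dirA2 (addFun H h) = dirA2 H + 2 * dir h := by
  have hm := hG.clm_comp (meanMap n)
  simp only [hT] at hm
  by_cases hh : MemW12 h
  · obtain ⟨g₁, g₂, hg⟩ := hh
    have h0 := hH.integral_inner_eq_zero hG hm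
    have hae : (fun z => ‖meanMap n (G₁ z)‖ ^ 2 + ‖meanMap n (G₂ z)‖ ^ 2)
        =ᵐ[volume.restrict disk] 0 := by
      rw [← integral_eq_zero_iff_of_nonneg (fun z => by positivity)
        (integrableOn_energy hm.isWeakGradient.memLp_re hm.isWeakGradient.memLp_im)]
      simpa only [real_inner_self_eq_norm_sq] using h0
    have hI : ∫ z in disk, (inner ℝ (meanMap n (G₁ z)) (g₁ z) +
        inner ℝ (meanMap n (G₂ z)) (g₂ z)) = 0 := by
      refine integral_eq_zero_of_ae ?_
      filter_upwards [hae] with z hz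
      have hz' : ‖meanMap n (G₁ z)‖ ^ 2 + ‖meanMap n (G₂ z)‖ ^ 2 = 0 := hz
      have h1 : meanMap n (G₁ z) = 0 := by
        rw [← norm_eq_zero, ← sq_eq_zero_iff]
        nlinarith [sq_nonneg ‖meanMap n (G₁ z)‖, sq_nonneg ‖meanMap n (G₂ z)‖]
      have h2 : meanMap n (G₂ z) = 0 := by
        rw [← norm_eq_zero, ← sq_eq_zero_iff]
        nlinarith [sq_nonneg ‖meanMap n (G₁ z)‖, sq_nonneg ‖meanMap n (G₂ z)‖]
      simp [h1, h2]
    rw [dirA2_addFun hG.isWeakGradient hg, hI, dirA2, hG.isWeakGradient.dir_eq_ofReal,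
      hg.dir_eq_ofReal, mul_zero, add_zero,
      ENNReal.ofReal_add (integral_nonneg fun z => by positivity)
        (mul_nonneg zero_le_two (integral_nonneg fun z => by positivity)),
      ENNReal.ofReal_mul zero_le_two, ENNReal.ofReal_ofNat]
  · have hadd : ¬ MemW12 fun z => zeta (addFun H h z) := by
      rintro ⟨p₁, p₂, hp⟩
      have hsub := (hp.clm_comp (meanMap n)).add
        (hm.isWeakGradient.clm_comp (-ContinuousLinearMap.id ℝ (E n)))
      simp only [zeta_addFun, map_add, meanMap_translationMap, neg_apply,
        ContinuousLinearMap.id_apply, add_neg_cancel_comm] at hsub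
      exact hh ⟨_, _, hsub⟩
    rw [dirA2, dir_eq_top hadd, dir_eq_top hh]
    simp

theorem dirA2_addFun_neg_of_mean_eq {n : ℕ} {H : ℂ → A2 n} {G₁ G₂ : ℂ → EN n} {f : ℂ → E n}
    (hG : IsWeakGradient (fun z => zeta (H z)) G₁ G₂)
    (hf : (fun z => meanMap n (zeta (H z))) =ᵐ[volume.restrict disk] f) :
    dirA2 (addFun H fun z => -f z) ≠ ⊤ ∧ dir f ≠ ⊤ ∧
      (dirA2 (addFun H fun z => -f z)).toReal = (dirA2 H).toReal - 2 * (dir f).toReal := by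
  have hm : IsWeakGradient f _ _ := (hG.clm_comp (meanMap n)).congr_ae hf
  have hneg : IsWeakGradient (fun z => -f z) (fun z => -meanMap n (G₁ z))
      (fun z => -meanMap n (G₂ z)) := by
    simpa using hm.clm_comp (-ContinuousLinearMap.id ℝ (E n))
  have hE := integral_energy_add_translationMap hG.memLp_re hG.memLp_im hneg.memLp_re
    hneg.memLp_im
  have h1 := dirA2_addFun hG hneg
  have hI : ∫ z in disk, (inner ℝ (meanMap n (G₁ z)) (-meanMap n (G₁ z)) +
      inner ℝ (meanMap n (G₂ z)) (-meanMap n (G₂ z))) =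
      -∫ z in disk, (‖meanMap n (G₁ z)‖ ^ 2 + ‖meanMap n (G₂ z)‖ ^ 2) := by
    rw [← integral_neg]
    simp only [inner_neg_right, real_inner_self_eq_norm_sq, neg_add]
  simp only [norm_neg] at h1
  rw [hI] at hE h1
  simp only [norm_neg] at hE
  have hpos := hE ▸ integral_nonneg fun z => by positivity
  rw [h1, dirA2, hG.dir_eq_ofReal, hm.dir_eq_ofReal]
  refine ⟨ENNReal.ofReal_ne_top, ENNReal.ofReal_ne_top, ?_⟩
  rw [ENNReal.toReal_ofReal hpos, ENNReal.toReal_ofReal (integral_nonneg fun z => by positivity),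
    ENNReal.toReal_ofReal (integral_nonneg fun z => by positivity)]
  ring

end TwoValued

theorem mainTheorem5 (n : ℕ) (H : ℂ → A2 n) (H₁ H₂ : Circle → E n) (h : ℂ → E n)
    (hH : IsDirMinimizing H)
    (hH₁ : Continuous H₁) (hH₂ : Continuous H₂)
    (htrace : HasTraceA2 H fun z => s(H₁ z, H₂ z))
    (hh : IsHarmonicExtension H₁ h) :
    ((∀ z, H₂ z = -H₁ z) →
      dirA2 (addFun H h) = dirA2 H + 2 * dir h) ∧
    ((∀ z, H₂ z = 0) →
      dirA2 (addFun H fun z => -((1 / 2 : ℝ) • h z)) ≠ ⊤ ∧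
      dir (fun z => (1 / 2 : ℝ) • h z) ≠ ⊤ ∧
      (dirA2 (addFun H fun z => -((1 / 2 : ℝ) • h z))).toReal =
        (dirA2 H).toReal - 2 * (dir fun z => (1 / 2 : ℝ) • h z).toReal) := by
  obtain ⟨G₁, G₂, hG⟩ := HasTrace.exists_isTraceGradient htrace
  refine ⟨fun h2 => ?_, fun h2 => ?_⟩
  · exact dirA2_addFun_of_mean_eq_zero hH hG (fun z => by rw [meanMap_zeta, h2]; simp) h
  · refine dirA2_addFun_neg_of_mean_eq hG.isWeakGradient ?_
    refine hH.mean_ae_eq hG (b := fun z => (1 / 2 : ℝ) • H₁ z)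
      (fun z => by rw [meanMap_zeta, h2, add_zero]) (by fun_prop) ?_
    exact
      { harmonic := hh.harmonic.const_smul
        continuousOn := by have := hh.continuousOn; fun_prop
        boundary := fun z => by rw [hh.boundary] }
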